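/- **Setting.** Let $X\subseteq\mathbb R^n$ (Borel), $f:X\to\mathbb R$, $c=(c_1,\dots,c_m):X\to\mathbb R^m$ with $m\ge 1$, and let $h(x)=\sum_{j=1}^m\max\{c_j(x),0\}$ for $x\in X$, $h(x)=+\infty$ otherwise. The parameters of the algorithm StoMADS-PB are $x_0\in X$, $\tau\in(0,1)\cap\mathbb Q$, $\hat z\in\mathbb N^*$, $\delta^0_p\in(0,\tau^{-\hat z}]$, $\varepsilon>0$, $\gamma>2$, and a matrix $\mathbf D\in\mathbb R^{n\times p}$ whose columns positively span $\mathbb R^n$; $b$ is the largest $\ell_\infty$-norm of a column. **Algorithm.** At iteration $k$ there are an $\varepsilon$-infeasible incumbent $x^k_{\rm inf}$, an $\varepsilon$-feasible incumbent $x^k_{\rm feas}$ (both equal to $x_0$ at $k=0$), a flag (initially FALSE) and a poll size $\delta^k_p$; put $\delta^k_m=\min\{\delta^k_p,(\delta^k_p)^2\}$, $V^k=\{x^k_{\rm inf},x^k_{\rm feas}\}$ if the flag is TRUE and $V^k=\{x^k_{\rm inf}\}$ otherwise. For $x\in V^k$ a finite positive spanning set $\mathbb D^k_p(x)$ of nonzero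 polling directions $d$ is chosen with $\delta^k_m\|d\|_\infty\le\delta^k_p b$ and $x+\delta^k_m d\in\{y+\delta^k_m\mathbf Dz: y\in V^k, z\in\mathbb Z^p\}$. The trial points are the points $x+\delta^k_m d\in X$ with $x\in V^k$, $d\in\mathbb D^k_p(x)$. Estimates $f^k_0,c^k_{j,0}$ of $f,c_j$ at $x\in\{x^k_{\rm inf},x^k_{\rm feas}\}$, and $f^k_s,c^k_{j,s}$ at the trial points $x+s$, are computed, and $$h^k_\bullet=\sum_j\max\{c^k_{j,\bullet},0\},\quad \ell^k_\bullet=\sum_j\max\{c^k_{j,\bullet}-\varepsilon(\delta^k_p)^2,0\},\quad u^k_\bullet=\sum_j\max\{c^k_{j,\bullet}+\varepsilon(\delta^k_p)^2,0\}\qquad(\bullet\in\{0,s\}).$$ The iteration is * *$f$-Dominating* if some trial point $x+s$ has $u^k_s(x+s)=0$ and, when the flag is TRUE, also $f^k_s(x+s)-f^k_0(x^k_{\rm feas})\le-\gamma\varepsilon(\delta^k_p)^2$; then $x^{k+1}_{\rm feas}=x+s$ for such a trial point, $x^{k+1}_{\rm inf}=x^k_{\rm inf}$, and the flag becomes TRUE;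 * otherwise *$h$-Dominating* if some trial point $x^k_{\rm inf}+s$ satisfies $h^k_s-h^k_0(x^k_{\rm inf})\le-\gamma m\varepsilon(\delta^k_p)^2$, $f^k_s-f^k_0(x^k_{\rm inf})\le-\gamma\varepsilon(\delta^k_p)^2$ and $0<u^k_s\le u^k_0(x^k_{\rm inf})$; then $x^{k+1}_{\rm inf}=x^k_{\rm inf}+s$ for such a trial point and $x^{k+1}_{\rm feas}=x^k_{\rm feas}$; * otherwise *Improving* if some trial point $x^k_{\rm inf}+s$ satisfies $h^k_s-h^k_0(x^k_{\rm inf})\le-\gamma m\varepsilon(\delta^k_p)^2$; then $x^{k+1}_{\rm inf}$ is one of these with the least $u^k_s$ and $x^{k+1}_{\rm feas}=x^k_{\rm feas}$; * otherwise *Unsuccessful*, and the incumbents do not change. In the first three cases $\delta^{k+1}_p=\min\{\tau^{-1}\delta^k_p,\tau^{-\hat z}\}$, in the last $\delta^{k+1}_p=\tau\delta^k_p$. The estimates are random variables on a probability space $(\Omega,\mathcal G,\mathbb P)$, so that the algorithm generates a stochastic process; capital letters denote the random quantities. $\mathcal F_{k-1}$ is the $\sigma$-algebra generated by the estimates of the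 iterations $0,\dots,k-1$; the incumbents, the flag, the poll size and the polling directions of iteration $k$ are $\mathcal F_{k-1}$-measurable. **Assumptions.** 1. $f$ and $h$ are locally Lipschitz on $X$, the $c_j$ are continuous on $X$, all realizations of the iterates lie in a compact set $U\subseteq X$, and $f$ is bounded below on $X$. 2. $T=\inf\{k: X^l_{\rm feas}\ne x_0\text{ for some }l\le k\}$ is almost surely finite or almost surely infinite. 3. $\nu,\alpha,\beta\in(0,1)$ satisfy $\frac{\nu}{1-\nu}\ge\frac{2(\tau^{-2}-1)}{\gamma-2}$, $\alpha\beta\ge\frac{4\nu}{(1-\nu)(1-\tau^2)}\left[(1-\alpha)^{1/2}+2(1-\beta)^{1/2}\right]$ and $\alpha\beta\in(1/2,1)$. 4. For all $k$ and $j$, almost surely: $\mathbb P(J_k|\mathcal F_{k-1})\ge\beta$, $\mathbb P(I^j_k|\mathcal F_{k-1})\ge\alpha^{1/m}$ and $\mathbb P(I_k|\mathcal F_{k-1})\ge\alpha$, where $J_k$ (resp. $I_k^j$) is the event that all the estimates of $f$ (resp. of $c_j$) at the incumbents and at the trial points of iteration $k$ are within $\varepsilon(\Delta^k_p)^2$ of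 the true values, and $I_k$ is the event that $\ell^k_0\le h\le u^k_0$ at the incumbents and $\ell^k_s\le h\le u^k_s$ at the trial points. For $X^k$ either incumbent, and for every random choice $X^k+S^k$ of a trial point (the expectations of the errors at $X^k+S^k$ being taken on the event that such a choice is made), $$\mathbb E[|F^k_0-f(X^k)|^2|\mathcal F_{k-1}],\ \mathbb E[|F^k_s-f(X^k+S^k)|^2|\mathcal F_{k-1}]\le\varepsilon^2(1-\sqrt\beta)(\Delta^k_p)^4,$$ $$\mathbb E[|C^k_{j,0}-c_j(X^k)|^2|\mathcal F_{k-1}],\ \mathbb E[|C^k_{j,s}-c_j(X^k+S^k)|^2|\mathcal F_{k-1}]\le\varepsilon^2(1-\alpha^{1/2m})(\Delta^k_p)^4,$$ $$\mathbb E[|H^k_0-h(X^k)||\mathcal F_{k-1}],\ \mathbb E[|H^k_s-h(X^k+S^k)||\mathcal F_{k-1}]\le m\varepsilon(1-\alpha)^{1/2}(\Delta^k_p)^2.$$ 5. There is $d_{\min}>0$ with $\delta^k_p\|d\|_\infty\ge d_{\min}$ for all $k$ and all polling directions $d$ of iteration $k$, in every realization. **Notions.** For $d\in\mathbb D^k_p(x^k_{\rm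 inf})$ let $\Psi^h_k(d)=\big(h(x^k_{\rm inf})-h(x^k_{\rm inf}+\delta^k_m d)\big)/\delta^k_p$. For an infinite $\mathcal K\subseteq\mathbb N$, $\hat x$ is a refined point of $\{x^k_{\rm inf}\}_{k\in\mathcal K}$ if $x^k_{\rm inf}\to\hat x$ and $\delta^k_m\to0$ along $\mathcal K$; then $v$ is a refining direction for $\hat x$ if $v=\lim_{k\in\mathcal L}d^k/\|d^k\|_\infty$ for some infinite $\mathcal L\subseteq\mathcal K$ and $d^k\in\mathbb D^k_p(x^k_{\rm inf})$. $T^H_X(\hat x)$ is the set of $v$ for which there is $\bar\epsilon>0$ with $y+tw\in X$ for all $y\in X\cap B_{\bar\epsilon}(\hat x)$, $w\in B_{\bar\epsilon}(v)$, $0<t<\bar\epsilon$; and $h^\circ(\hat x;v)=\limsup \frac{h(y+tv)-h(y)}{t}$ as $y\to\hat x$, $y\in X$, $t\searrow0$, $y+tv\in X$. **Theorem.** Under these assumptions there are strictly increasing sequences $K'$ and $K\subseteq K'$ of $\mathbb N$-valued random variables and a random vector $\hat X_{\rm inf}$ such that, almost surely, $\Delta^k_p\to0$, $\limsup_{k\in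 K'}\Psi^h_k(d^k)\le0$ for all choices of $d^k\in\mathbb D^k_p(X^k_{\rm inf})$, and $\{X^k_{\rm inf}\}_{k\in K}$ is a refining subsequence of the $\varepsilon$-infeasible incumbents with refined point $\hat X_{\rm inf}\in X$. Moreover, in every realization in which $\Delta^k_p\to0$ and $\limsup_{K'}\Psi^h_k(d^k)\le0$ for all choices of $d^k$, if $\hat x_{\rm inf}\in X$ is a refined point of the realization of $\{X^k_{\rm inf}\}_{k\in K}$ and $v\in T^H_X(\hat x_{\rm inf})$ is a refining direction for $\hat x_{\rm inf}$, then $h^\circ(\hat x_{\rm inf};v)\ge0$. In particular, with probability one there exist an infinite $\mathcal K\subseteq\mathbb N$ and a refined point $\hat x\in X$ of $\{X^k_{\rm inf}\}_{k\in\mathcal K}$ such that $h^\circ(\hat x;v)\ge0$ for every refining direction $v\in T^H_X(\hat x)$ for $\hat x$. -/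

import Mathlib

open Filter Topology MeasureTheory
open scoped NNReal

namespace StoMADSPB

/-- Points of `ℝⁿ`. The norm of this type is the `ℓ∞`-norm. -/
abbrev Pt (n : ℕ) : Type := Fin n → ℝ

/-- The constraint violation `∑ⱼ max {cⱼ(x), 0}` at a point of `X`. -/
def violation {n m : ℕ} (c : Fin m → Pt n → ℝ) (x : Pt n) : ℝ := ∑ j, max (c j x) 0

open Classical in
/-- The constraint violation function `h : ℝⁿ → ℝ ∪ {+∞}`. -/
noncomputable def violationExt {n m : ℕ} (X : Set (Pt n)) (c : Fin m → Pt n → ℝ) (x : Pt n) :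
    EReal :=
  if x ∈ X then ((violation c x : ℝ) : EReal) else ⊤

/-- A set whose nonnegative linear combinations fill the whole space. -/
def PositivelySpans {n : ℕ} (S : Set (Pt n)) : Prop := Submodule.span ℝ≥0 S = ⊤

/-- The hypertangent cone to `O` at `x`. -/
def hypertangentCone {n : ℕ} (O : Set (Pt n)) (x : Pt n) : Set (Pt n) :=
  {v | ∃ e > 0, ∀ y ∈ O ∩ Metric.ball x e, ∀ w ∈ Metric.ball v e, ∀ t : ℝ, 0 < t → t < e →
    y + t • w ∈ O}

/-- The Clarke generalized derivative of `g` at `x` in the direction `v`, relative to `X`: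
the upper limit of `(g (y + t v) - g y) / t` as `y → x` with `y ∈ X` and `t ↘ 0` with
`y + t v ∈ X`. -/
noncomputable def clarkeDeriv {n : ℕ} (X : Set (Pt n)) (g : Pt n → ℝ) (x v : Pt n) : EReal :=
  limsup (fun q : Pt n × ℝ => (((g (q.1 + q.2 • v) - g q.1) / q.2 : ℝ) : EReal))
    ((𝓝[X] x ×ˢ 𝓝[>] (0 : ℝ)) ⊓ 𝓟 {q | q.1 + q.2 • v ∈ X})

/-- The two incumbent solutions: `inf` (the `ε`-infeasible one) and `feas` (the `ε`-feasible
one). -/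
abbrev Incumbent : Type := Bool

/-- The label of the `ε`-infeasible incumbent. -/
abbrev inf : Incumbent := false

/-- The label of the `ε`-feasible incumbent. -/
abbrev feas : Incumbent := true

/-- The input parameters of the algorithm; `D` lists the columns of the matrix that defines the
mesh. -/
structure Params (n p : ℕ) (X : Set (Pt n)) where
  x₀ : Pt n
  x₀_mem : x₀ ∈ X
  τ : ℝ
  τ_pos : 0 < τ
  τ_lt_one : τ < 1
  τ_rat : ∃ q : ℚ, (q : ℝ) = τ
  zhat : ℕ
  zhat_pos : 0 < zhat
  δ₀ : ℝ
  δ₀_pos : 0 < δ₀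
  δ₀_le : δ₀ ≤ τ⁻¹ ^ zhat
  ε : ℝ
  ε_pos : 0 < ε
  γ : ℝ
  two_lt_γ : 2 < γ
  D : Fin p → Pt n
  D_spans : PositivelySpans (Set.range D)

/-- The largest norm of a column of `D`. -/
noncomputable def Params.b {n p : ℕ} {X : Set (Pt n)} (P : Params n p X) : ℝ := ⨆ i, ‖P.D i‖

/-- The random quantities that appear in a run of the algorithm: at the beginning of iteration `k`
the incumbents `x k inf` and `x k feas`, the feasibility flag and the poll size parameter `Δ k`;
then the list of the `num k c` polling directions `dir k c i`, `i < num k c`, around `x k c`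
(repetitions are allowed), the estimates `F0`, `C0` of `f`, `cⱼ` at the incumbents, and the
estimates `Fs`, `Cs` at the trial points. A pair `(c, i)` labels the `i`-th trial point around
the incumbent `c`. -/
structure Run (Ω : Type*) (n m : ℕ) where
  x : ℕ → Incumbent → Ω → Pt n
  flag : ℕ → Ω → Bool
  Δ : ℕ → Ω → ℝ
  num : ℕ → Incumbent → Ω → ℕ
  dir : ℕ → Incumbent → ℕ → Ω → Pt n
  F0 : ℕ → Incumbent → Ω → ℝ
  C0 : ℕ → Incumbent → Fin m → Ω → ℝ
  Fs : ℕ → Incumbent × ℕ → Ω → ℝ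
  Cs : ℕ → Incumbent × ℕ → Fin m → Ω → ℝ

namespace Run

variable {Ω : Type*} {n m p : ℕ} {X : Set (Pt n)}

/-- The mesh size parameter. -/
noncomputable def Δm (A : Run Ω n m) (k : ℕ) (ω : Ω) : ℝ := min (A.Δ k ω) (A.Δ k ω ^ 2)

/-- The incumbent `c` belongs to the current set of incumbents: `x k inf` always does, `x k feas`
does once an `ε`-feasible point has been found. -/
def Active (A : Run Ω n m) (k : ℕ) (c : Incumbent) (ω : Ω) : Prop :=
  c = feas → A.flag k ω = true

/-- The set of polling directions around the incumbent `c`. -/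
def pollDirs (A : Run Ω n m) (k : ℕ) (c : Incumbent) (ω : Ω) : Set (Pt n) :=
  {d | ∃ i < A.num k c ω, d = A.dir k c i ω}

/-- The mesh. -/
noncomputable def mesh (A : Run Ω n m) (P : Params n p X) (k : ℕ) (ω : Ω) : Set (Pt n) :=
  {z | ∃ c, A.Active k c ω ∧ ∃ y : Fin p → ℤ,
    z = A.x k c ω + A.Δm k ω • ∑ i, (y i : ℝ) • P.D i}

/-- The point `x k c + δₘ d` for the polling direction with label `s = (c, i)`. -/
noncomputable def pt (A : Run Ω n m) (k : ℕ) (s : Incumbent × ℕ) (ω : Ω) : Pt n :=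
  A.x k s.1 ω + A.Δm k ω • A.dir k s.1 s.2 ω

/-- The labels of the points of the poll set. -/
def trial (A : Run Ω n m) (X : Set (Pt n)) (k : ℕ) (ω : Ω) : Set (Incumbent × ℕ) :=
  {s | A.Active k s.1 ω ∧ s.2 < A.num k s.1 ω ∧ A.pt k s ω ∈ X}

/-- Estimated violation at an incumbent. -/
noncomputable def H0 (A : Run Ω n m) (k : ℕ) (c : Incumbent) (ω : Ω) : ℝ :=
  ∑ j, max (A.C0 k c j ω) 0

/-- Estimated violation at a trial point. -/
noncomputable def Hs (A : Run Ω n m) (k : ℕ) (s : Incumbent × ℕ) (ω : Ω) : ℝ :=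
  ∑ j, max (A.Cs k s j ω) 0

/-- Lower bound for the violation at an incumbent. -/
noncomputable def L0 (A : Run Ω n m) (P : Params n p X) (k : ℕ) (c : Incumbent) (ω : Ω) : ℝ :=
  ∑ j, max (A.C0 k c j ω - P.ε * A.Δ k ω ^ 2) 0

/-- Upper bound for the violation at an incumbent. -/
noncomputable def U0 (A : Run Ω n m) (P : Params n p X) (k : ℕ) (c : Incumbent) (ω : Ω) : ℝ :=
  ∑ j, max (A.C0 k c j ω + P.ε * A.Δ k ω ^ 2) 0

/-- Lower bound for the violation at a trial point. -/
noncomputable def Ls (A : Run Ω n m) (P : Params n p X) (k : ℕ) (s : Incumbent × ℕ) (ω : Ω) :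
    ℝ :=
  ∑ j, max (A.Cs k s j ω - P.ε * A.Δ k ω ^ 2) 0

/-- Upper bound for the violation at a trial point. -/
noncomputable def Us (A : Run Ω n m) (P : Params n p X) (k : ℕ) (s : Incumbent × ℕ) (ω : Ω) :
    ℝ :=
  ∑ j, max (A.Cs k s j ω + P.ε * A.Δ k ω ^ 2) 0

/-- The barrier threshold. -/
noncomputable def hmax (A : Run Ω n m) (P : Params n p X) (k : ℕ) (ω : Ω) : ℝ :=
  A.U0 P k inf ω

/-- The trial point `s` makes the iteration `f`-Dominating: it is the first `ε`-feasible point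
found, or it is `ε`-feasible and dominates the `ε`-feasible incumbent. -/
def FTest (A : Run Ω n m) (P : Params n p X) (k : ℕ) (s : Incumbent × ℕ) (ω : Ω) : Prop :=
  A.Us P k s ω = 0 ∧
    (A.flag k ω = true → A.Fs k s ω - A.F0 k feas ω ≤ -(P.γ * P.ε * A.Δ k ω ^ 2))

/-- The trial point `s` around `x k inf` satisfies the sufficient decrease of the estimated
violation. -/
def ITest (A : Run Ω n m) (P : Params n p X) (k : ℕ) (s : Incumbent × ℕ) (ω : Ω) : Prop :=
  s.1 = inf ∧ A.Hs k s ω - A.H0 k inf ω ≤ -(P.γ * m * P.ε * A.Δ k ω ^ 2)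

/-- The trial point `s` around `x k inf` is `ε`-infeasible and dominates `x k inf`. -/
def HTest (A : Run Ω n m) (P : Params n p X) (k : ℕ) (s : Incumbent × ℕ) (ω : Ω) : Prop :=
  A.ITest P k s ω ∧ A.Fs k s ω - A.F0 k inf ω ≤ -(P.γ * P.ε * A.Δ k ω ^ 2) ∧
    0 < A.Us P k s ω ∧ A.Us P k s ω ≤ A.hmax P k ω

/-- The iteration is `f`-Dominating. -/
def FDominating (A : Run Ω n m) (P : Params n p X) (k : ℕ) (ω : Ω) : Prop :=
  ∃ s ∈ A.trial X k ω, A.FTest P k s ω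

/-- The iteration is `h`-Dominating. -/
def HDominating (A : Run Ω n m) (P : Params n p X) (k : ℕ) (ω : Ω) : Prop :=
  ¬ A.FDominating P k ω ∧ ∃ s ∈ A.trial X k ω, A.HTest P k s ω

/-- The iteration is Improving. -/
def Improving (A : Run Ω n m) (P : Params n p X) (k : ℕ) (ω : Ω) : Prop :=
  ¬ A.FDominating P k ω ∧ ¬ A.HDominating P k ω ∧ ∃ s ∈ A.trial X k ω, A.ITest P k s ω

/-- The iteration is Unsuccessful. -/
def Unsuccessful (A : Run Ω n m) (P : Params n p X) (k : ℕ) (ω : Ω) : Prop :=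
  ¬ A.FDominating P k ω ∧ ¬ A.HDominating P k ω ∧ ¬ A.Improving P k ω

/-- The `σ`-algebra generated by the estimates of the iterations `0, …, k - 1`. -/
def past (A : Run Ω n m) (k : ℕ) : MeasurableSpace Ω :=
  ⨆ (l : ℕ) (_ : l < k),
    (⨆ c, MeasurableSpace.comap (A.F0 l c) inferInstance) ⊔
    (⨆ (c) (j), MeasurableSpace.comap (A.C0 l c j) inferInstance) ⊔
    (⨆ s, MeasurableSpace.comap (A.Fs l s) inferInstance) ⊔
    (⨆ (s) (j), MeasurableSpace.comap (A.Cs l s j) inferInstance)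

/-- `A` is the stochastic process generated by the algorithm with parameters `P`. All the
randomness stems from the estimates: what is known at the beginning of iteration `k`, and the
polling directions then chosen, are determined by the estimates of the earlier iterations. -/
structure IsGenerated [MeasurableSpace Ω] (A : Run Ω n m) (P : Params n p X) : Prop where
  measurable_F0 : ∀ k c, Measurable (A.F0 k c)
  measurable_C0 : ∀ k c j, Measurable (A.C0 k c j)
  measurable_Fs : ∀ k s, Measurable (A.Fs k s)
  measurable_Cs : ∀ k s j, Measurable (A.Cs k s j)
  adapted_x : ∀ k c, Measurable[A.past k] (A.x k c)
  adapted_flag : ∀ k, Measurable[A.past k] (A.flag k)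
  adapted_Δ : ∀ k, Measurable[A.past k] (A.Δ k)
  adapted_num : ∀ k c, Measurable[A.past k] (A.num k c)
  adapted_dir : ∀ k c i, Measurable[A.past k] (A.dir k c i)
  init_x : ∀ c ω, A.x 0 c ω = P.x₀
  init_flag : ∀ ω, A.flag 0 ω = false
  init_Δ : ∀ ω, A.Δ 0 ω = P.δ₀
  dirs_span : ∀ k c ω, A.Active k c ω → PositivelySpans (A.pollDirs k c ω)
  dirs_ne_zero : ∀ k c ω, A.Active k c ω → ∀ d ∈ A.pollDirs k c ω, d ≠ 0
  dirs_mesh : ∀ k c ω, A.Active k c ω → ∀ d ∈ A.pollDirs k c ω,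
    A.x k c ω + A.Δm k ω • d ∈ A.mesh P k ω
  dirs_frame : ∀ k c ω, A.Active k c ω → ∀ d ∈ A.pollDirs k c ω,
    A.Δm k ω * ‖d‖ ≤ A.Δ k ω * P.b
  step_f : ∀ k ω, A.FDominating P k ω →
    A.x (k + 1) inf ω = A.x k inf ω ∧
    (∃ s ∈ A.trial X k ω, A.FTest P k s ω ∧ A.x (k + 1) feas ω = A.pt k s ω) ∧
    A.flag (k + 1) ω = true ∧
    A.Δ (k + 1) ω = min (P.τ⁻¹ * A.Δ k ω) (P.τ⁻¹ ^ P.zhat)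
  step_h : ∀ k ω, A.HDominating P k ω →
    (∃ s ∈ A.trial X k ω, A.HTest P k s ω ∧ A.x (k + 1) inf ω = A.pt k s ω) ∧
    A.x (k + 1) feas ω = A.x k feas ω ∧
    A.flag (k + 1) ω = A.flag k ω ∧
    A.Δ (k + 1) ω = min (P.τ⁻¹ * A.Δ k ω) (P.τ⁻¹ ^ P.zhat)
  step_improving : ∀ k ω, A.Improving P k ω →
    (∃ s ∈ A.trial X k ω, A.ITest P k s ω ∧
      (∀ s' ∈ A.trial X k ω, A.ITest P k s' ω → A.Us P k s ω ≤ A.Us P k s' ω) ∧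
      A.x (k + 1) inf ω = A.pt k s ω) ∧
    A.x (k + 1) feas ω = A.x k feas ω ∧
    A.flag (k + 1) ω = A.flag k ω ∧
    A.Δ (k + 1) ω = min (P.τ⁻¹ * A.Δ k ω) (P.τ⁻¹ ^ P.zhat)
  step_unsuccessful : ∀ k ω, A.Unsuccessful P k ω →
    A.x (k + 1) inf ω = A.x k inf ω ∧
    A.x (k + 1) feas ω = A.x k feas ω ∧
    A.flag (k + 1) ω = A.flag k ω ∧
    A.Δ (k + 1) ω = P.τ * A.Δ k ω

/-- The random time `T` at which a first `ε`-feasible iterate is available. -/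
noncomputable def T (A : Run Ω n m) (P : Params n p X) (ω : Ω) : ℕ∞ :=
  sInf {t : ℕ∞ | ∃ k : ℕ, t = (k : ℕ∞) ∧ ∃ l ≤ k, A.x l feas ω ≠ P.x₀}

/-- The event that the estimates of `f` at the incumbents and at the trial points of iteration
`k` are `ε`-accurate. -/
def J (A : Run Ω n m) (P : Params n p X) (f : Pt n → ℝ) (k : ℕ) : Set Ω :=
  {ω | (∀ c, |A.F0 k c ω - f (A.x k c ω)| ≤ P.ε * A.Δ k ω ^ 2) ∧
    ∀ s ∈ A.trial X k ω, |A.Fs k s ω - f (A.pt k s ω)| ≤ P.ε * A.Δ k ω ^ 2}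

/-- The event that the estimates of `cⱼ` at the incumbents and at the trial points of iteration
`k` are `ε`-accurate. -/
def Ij (A : Run Ω n m) (P : Params n p X) (c : Fin m → Pt n → ℝ) (j : Fin m) (k : ℕ) : Set Ω :=
  {ω | (∀ i, |A.C0 k i j ω - c j (A.x k i ω)| ≤ P.ε * A.Δ k ω ^ 2) ∧
    ∀ s ∈ A.trial X k ω, |A.Cs k s j ω - c j (A.pt k s ω)| ≤ P.ε * A.Δ k ω ^ 2}

/-- The event that the bounds for the violation at the incumbents and at the trial points of
iteration `k` are reliable. -/
def I (A : Run Ω n m) (P : Params n p X) (c : Fin m → Pt n → ℝ) (k : ℕ) : Set Ω :=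
  {ω | (∀ i, A.L0 P k i ω ≤ violation c (A.x k i ω) ∧ violation c (A.x k i ω) ≤ A.U0 P k i ω) ∧
    ∀ s ∈ A.trial X k ω,
      A.Ls P k s ω ≤ violation c (A.pt k s ω) ∧ violation c (A.pt k s ω) ≤ A.Us P k s ω}

/-- `ℙ(E | past) ≥ q`. -/
def CondProbGe [MeasurableSpace Ω] (μ : Measure Ω) (A : Run Ω n m) (k : ℕ) (E : Set Ω)
    (q : ℝ) : Prop :=
  MeasurableSet E ∧ ∀ᵐ ω ∂μ, q ≤ (μ[E.indicator (fun _ => (1 : ℝ)) | A.past k]) ω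

/-- `𝔼[Z | past] ≤ B`. -/
def CondExpLe [MeasurableSpace Ω] (μ : Measure Ω) (A : Run Ω n m) (k : ℕ) (Z B : Ω → ℝ) :
    Prop :=
  Integrable Z μ ∧ ∀ᵐ ω ∂μ, (μ[Z | A.past k]) ω ≤ B ω

/-- `𝔼[Z(s) | past] ≤ B`, where `s` is any random choice of a trial point of iteration `k`
(which need not be determined by the past), on the event that it is a trial point. -/
def CondExpTrialLe [MeasurableSpace Ω] (μ : Measure Ω) (A : Run Ω n m) (X : Set (Pt n)) (k : ℕ)
    (Z : Incumbent × ℕ → Ω → ℝ) (B : Ω → ℝ) : Prop :=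
  ∀ s : Ω → Incumbent × ℕ, Measurable s →
    CondExpLe μ A k ({ω | s ω ∈ A.trial X k ω}.indicator (fun ω => Z (s ω) ω)) B

/-- The accuracy requirements on the estimates and on the bounds, for given levels
`α` and `β`. -/
structure Accurate [MeasurableSpace Ω] (μ : Measure Ω) (A : Run Ω n m) (P : Params n p X)
    (f : Pt n → ℝ) (c : Fin m → Pt n → ℝ) (α β : ℝ) : Prop where
  prob_f : ∀ k, CondProbGe μ A k (A.J P f k) β
  var_fs : ∀ k, CondExpTrialLe μ A X k (fun s ω => |A.Fs k s ω - f (A.pt k s ω)| ^ 2)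
    (fun ω => P.ε ^ 2 * (1 - √β) * A.Δ k ω ^ 4)
  var_f0 : ∀ k i, CondExpLe μ A k (fun ω => |A.F0 k i ω - f (A.x k i ω)| ^ 2)
    (fun ω => P.ε ^ 2 * (1 - √β) * A.Δ k ω ^ 4)
  prob_c : ∀ k j, CondProbGe μ A k (A.Ij P c j k) (α ^ (1 / (m : ℝ)))
  var_cs : ∀ k j, CondExpTrialLe μ A X k (fun s ω => |A.Cs k s j ω - c j (A.pt k s ω)| ^ 2)
    (fun ω => P.ε ^ 2 * (1 - α ^ (1 / (2 * (m : ℝ)))) * A.Δ k ω ^ 4)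
  var_c0 : ∀ k j i, CondExpLe μ A k (fun ω => |A.C0 k i j ω - c j (A.x k i ω)| ^ 2)
    (fun ω => P.ε ^ 2 * (1 - α ^ (1 / (2 * (m : ℝ)))) * A.Δ k ω ^ 4)
  prob_bounds : ∀ k, CondProbGe μ A k (A.I P c k) α
  mean_hs : ∀ k, CondExpTrialLe μ A X k (fun s ω => |A.Hs k s ω - violation c (A.pt k s ω)|)
    (fun ω => m * P.ε * √(1 - α) * A.Δ k ω ^ 2)
  mean_h0 : ∀ k i, CondExpLe μ A k (fun ω => |A.H0 k i ω - violation c (A.x k i ω)|)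
    (fun ω => m * P.ε * √(1 - α) * A.Δ k ω ^ 2)

/-- The quotient `(h(x) - h(x + δₘ d)) / δₚ` at `x = x k inf`; it is `-∞` when `x + δₘ d` is not
in `X`. -/
noncomputable def Ψ (A : Run Ω n m) (X : Set (Pt n)) (c : Fin m → Pt n → ℝ) (k : ℕ) (d : Pt n)
    (ω : Ω) : EReal :=
  (violationExt X c (A.x k inf ω) - violationExt X c (A.x k inf ω + A.Δm k ω • d)) /
    ((A.Δ k ω : ℝ) : EReal)

/-- The upper limit of `Ψ` along the indices `κ 0 < κ 1 < …` is at most `0`, whatever polling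
directions around `x k inf` are chosen. -/
def PsiLimLe (A : Run Ω n m) (X : Set (Pt n)) (c : Fin m → Pt n → ℝ) (κ : ℕ → ℕ) (ω : Ω) :
    Prop :=
  ∀ d : ℕ → Pt n, (∀ k, d k ∈ A.pollDirs k inf ω) →
    limsup (fun i => A.Ψ X c (κ i) (d (κ i)) ω) atTop ≤ 0

/-- Along the indices `κ 0 < κ 1 < …`, the incumbents `x k inf` form a refining subsequence with
refined point `z`. -/
def IsRefinedPoint (A : Run Ω n m) (κ : ℕ → ℕ) (ω : Ω) (z : Pt n) : Prop :=
  Tendsto (fun i => A.x (κ i) inf ω) atTop (𝓝 z) ∧ Tendsto (fun i => A.Δm (κ i) ω) atTop (𝓝 0)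

/-- `v` is a refining direction for the refined point of the subsequence with indices
`κ 0 < κ 1 < …`; the set of the indices `φ j` is an infinite subset of those. -/
def IsRefiningDirection (A : Run Ω n m) (κ : ℕ → ℕ) (ω : Ω) (v : Pt n) : Prop :=
  ∃ φ : ℕ → ℕ, StrictMono φ ∧ Set.range φ ⊆ Set.range κ ∧
    ∃ d : ℕ → Pt n, (∀ j, d j ∈ A.pollDirs (φ j) inf ω) ∧
      Tendsto (fun j => ‖d j‖⁻¹ • d j) atTop (𝓝 v)

end Run

end StoMADSPB

/-!
The potential of the process is a weighted sum of the objective value of the `ε`-feasible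
incumbent, the violation of the `ε`-infeasible one and `Δ ^ 2`. A successful iteration with accurate
estimates decreases one of the first two terms by more than the last one grows, an unsuccessful
iteration decreases the last one, and inaccurate estimates can do harm only to the extent of the
estimation errors, whose conditional moments are bounded by multiples of `Δ ^ 2`. The constants are
such that the expected potential decreases by a multiple of the expectation of `Δ ^ 2` in each
iteration (`integral_potential_succ_le`). The events `I` and `J` need not be independent. As long as
there is no `ε`-feasible incumbent, a large constant replaces its objective value, so that the
appearance of one decreases the potential as well. Since the potential is bounded below, the
expectations of `Δ ^ 2` are summable, and `Δ` tends to zero almost surely (`ae_tendsto_Δ_zero`).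

Let `W` be the random walk that moves up in the iterations with reliable violation bounds and down
in the others. As `α > 1 / 2`, it tends to infinity (`ae_tendsto_zpow_walk`). A reliable iteration
in which some quotient `Ψ` exceeds a fixed positive number is successful once `Δ` is small. If all
iterations from some index on had such a quotient, then `Δ` would be at least a multiple of
`τ ^ (-W)`, which is impossible. So the quotients are arbitrarily small infinitely often
(`frequently_smallDecrease`), and choosing such indices greedily gives `K'`; a measurable
Bolzano–Weierstrass argument (`exists_measurable_convergent_subsequence`) gives `K`.

The statement on single realizations is a comparison of difference quotients
(`IsGenerated.clarkeDeriv_nonneg`): along a refining direction the step length `δₘ ‖d‖` is at least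
a multiple of `δₚ`, so the limit behaviour of `Ψ` passes to the difference quotients of the
violation, and the local Lipschitz property allows the normalized polling directions to be replaced
by their limit.
-/

namespace StoMADSPB

/-! ### Conditional expectations and convergence of sequences of random variables -/

/-- Taking out what is known, in integrated form: a bounded factor that is measurable with respect
to the smaller `σ`-algebra does not notice the conditioning. -/
theorem integral_mul_condExp_of_bound {Ω : Type*} {m mΩ : MeasurableSpace Ω} (hm : m ≤ mΩ)
    {μ : Measure Ω} [IsFiniteMeasure μ] {w Z : Ω → ℝ} (hw : Measurable[m] w) {C : ℝ}
    (hC : ∀ ω, |w ω| ≤ C) (hZ : Integrable Z μ) :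
    ∫ ω, w ω * (μ[Z | m]) ω ∂μ = ∫ ω, w ω * Z ω ∂μ := by
  have h := condExp_stronglyMeasurable_mul_of_bound hm (μ := μ) (f := w) (g := Z)
    hw.stronglyMeasurable hZ C (Eventually.of_forall hC)
  calc ∫ ω, w ω * (μ[Z | m]) ω ∂μ = ∫ ω, (μ[w * Z | m]) ω ∂μ :=
        integral_congr_ae (h.mono fun ω hω => hω.symm)
    _ = ∫ ω, w ω * Z ω ∂μ := integral_condExp hm

/-- If the integrals of nonnegative functions are summable, the functions tend to zero almost
everywhere. -/
theorem ae_tendsto_zero_of_summable_integral {Ω : Type*} [MeasurableSpace Ω] {μ : Measure Ω}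
    {u : ℕ → Ω → ℝ} (hu : ∀ k, Integrable (u k) μ) (h0 : ∀ k ω, 0 ≤ u k ω)
    (hs : Summable fun k => ∫ ω, u k ω ∂μ) : ∀ᵐ ω ∂μ, Tendsto (fun k => u k ω) atTop (𝓝 0) := by
  have hfin : ∫⁻ ω, ∑' k, ENNReal.ofReal (u k ω) ∂μ ≠ ⊤ := by
    rw [lintegral_tsum fun k => (hu k).aestronglyMeasurable.aemeasurable.ennreal_ofReal]
    have h1 : ∀ k, ∫⁻ ω, ENNReal.ofReal (u k ω) ∂μ = ENNReal.ofReal (∫ ω, u k ω ∂μ) := fun k =>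
      (ofReal_integral_eq_lintegral_ofReal (hu k) (Eventually.of_forall (h0 k))).symm
    simp_rw [h1]
    rw [← ENNReal.ofReal_tsum_of_nonneg (fun k => integral_nonneg (h0 k)) hs]
    exact ENNReal.ofReal_ne_top
  have hae := ae_lt_top' (AEMeasurable.tsum fun k =>
    (hu k).aestronglyMeasurable.aemeasurable.ennreal_ofReal) hfin
  filter_upwards [hae] with ω hω
  have h2 := ENNReal.tendsto_atTop_zero_of_tsum_ne_top hω.ne
  have h3 := (ENNReal.tendsto_toReal ENNReal.zero_ne_top).comp h2
  simpa [Function.comp_def, ENNReal.toReal_ofReal (h0 _ ω)] using h3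

/-! ### Measurable choice of subsequences -/

/-- A sequence of measurable functions, evaluated at a random index, is measurable. -/
theorem measurable_eval_nat {Ω α : Type*} [MeasurableSpace Ω] [MeasurableSpace α]
    {g : ℕ → Ω → α} (hg : ∀ k, Measurable (g k)) {κ : Ω → ℕ} (hκ : Measurable κ) :
    Measurable fun ω => g (κ ω) ω :=
  (measurable_from_prod_countable_right (f := fun q : ℕ × Ω => g q.1 q.2) hg).comp
    (hκ.prodMk measurable_id)

/-- Greedy choice: the `i`-th index is the least one beyond its predecessor at which the event
`G i` occurs, whenever there is one. -/
theorem exists_measurable_strictMono_mem {Ω : Type*} [MeasurableSpace Ω] (G : ℕ → ℕ → Set Ω)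
    (hG : ∀ i k, MeasurableSet (G i k)) :
    ∃ κ : ℕ → Ω → ℕ, (∀ i, Measurable (κ i)) ∧ (∀ ω, StrictMono fun i => κ i ω) ∧
      ∀ ω, (∀ i, ∃ᶠ k in atTop, ω ∈ G i k) → ∀ i, ω ∈ G i (κ i ω) := by
  classical
  -- If the event never occurs again, every larger index qualifies, which makes the search total.
  let p : ℕ → ℕ → Ω → ℕ → Prop := fun i a ω k => a ≤ k ∧ (ω ∈ G i k ∨ ∀ k', a ≤ k' → ω ∉ G i k')
  have hp : ∀ i a ω, ∃ k, p i a ω k := by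
    intro i a ω
    by_cases h : ∃ k, a ≤ k ∧ ω ∈ G i k
    · obtain ⟨k, hk, hk'⟩ := h
      exact ⟨k, hk, Or.inl hk'⟩
    · exact ⟨a, le_rfl, Or.inr fun k' hk' hmem => h ⟨k', hk', hmem⟩⟩
  let next : ℕ → ℕ → Ω → ℕ := fun i a ω => Nat.find (hp i a ω)
  have hnext : ∀ i a, Measurable (next i a) := by
    intro i a
    refine measurable_find _ fun k => ?_
    have hset : {ω | p i a ω k} = {ω | a ≤ k} ∩ (G i k ∪ ⋂ k', ⋂ (_ : a ≤ k'), (G i k')ᶜ) := by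
      ext ω
      simp [p]
    rw [hset]
    exact (MeasurableSet.const _).inter ((hG i k).union
      (MeasurableSet.iInter fun k' => MeasurableSet.iInter fun _ => (hG i k').compl))
  let κ : ℕ → Ω → ℕ := fun i ω => Nat.rec (next 0 0 ω) (fun j a => next (j + 1) (a + 1) ω) i
  have hmeas : ∀ i, Measurable (κ i) := by
    intro i
    induction i with
    | zero => exact hnext 0 0
    | succ j ih =>
      exact measurable_eval_nat (g := fun a ω => next (j + 1) (a + 1) ω)
        (fun a => hnext (j + 1) (a + 1)) ih
  have hmem : ∀ i a ω, (∃ᶠ k in atTop, ω ∈ G i k) → ω ∈ G i (next i a ω) := by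
    intro i a ω hfr
    obtain ⟨k, hk, hk'⟩ := (frequently_atTop.1 hfr) a
    rcases (Nat.find_spec (hp i a ω)).2 with h | h
    · exact h
    · exact absurd hk' (h k hk)
  refine ⟨κ, hmeas, fun ω => strictMono_nat_of_lt_succ fun i => ?_, fun ω hω i => ?_⟩
  · exact Nat.lt_of_succ_le (Nat.find_spec (hp (i + 1) (κ i ω + 1) ω)).1
  · cases i with
    | zero => exact hmem 0 0 ω (hω 0)
    | succ j => exact hmem (j + 1) (κ j ω + 1) ω (hω (j + 1))

/-- A bounded sequence of real random variables converges along random indices, namely to its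
upper limit. -/
theorem exists_measurable_strictMono_tendsto {Ω : Type*} [MeasurableSpace Ω] {y : ℕ → Ω → ℝ}
    (hy : ∀ k, Measurable (y k)) {R : ℝ} (hR : ∀ k ω, |y k ω| ≤ R) :
    ∃ σ : ℕ → Ω → ℕ, (∀ i, Measurable (σ i)) ∧ (∀ ω, StrictMono fun i => σ i ω) ∧
      ∀ ω, ∃ l : ℝ, Tendsto (fun i => y (σ i ω) ω) atTop (𝓝 l) := by
  let L : Ω → ℝ := fun ω => limsup (fun k => y k ω) atTop
  have hL : Measurable L := Measurable.limsup hy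
  let G : ℕ → ℕ → Set Ω := fun i k => {ω | |y k ω - L ω| ≤ 1 / ((i : ℝ) + 1)}
  have hG : ∀ i k, MeasurableSet (G i k) := fun i k =>
    measurableSet_le (((hy k).sub hL).abs) measurable_const
  obtain ⟨σ, hσ, hmono, hmem⟩ := exists_measurable_strictMono_mem G hG
  refine ⟨σ, hσ, hmono, fun ω => ⟨L ω, ?_⟩⟩
  have hbdd : IsBoundedUnder (· ≤ ·) atTop fun k => y k ω :=
    isBoundedUnder_of ⟨R, fun k => (abs_le.1 (hR k ω)).2⟩
  have hbdd' : IsBoundedUnder (· ≥ ·) atTop fun k => y k ω :=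
    isBoundedUnder_of ⟨-R, fun k => (abs_le.1 (hR k ω)).1⟩
  have hfr : ∀ i, ∃ᶠ k in atTop, ω ∈ G i k := by
    intro i
    have hi : (0 : ℝ) < 1 / ((i : ℝ) + 1) := by positivity
    have h1 : ∃ᶠ k in atTop, L ω - 1 / ((i : ℝ) + 1) < y k ω :=
      frequently_lt_of_lt_limsup hbdd'.isCoboundedUnder_le (by simp only [L]; linarith)
    have h2 : ∀ᶠ k in atTop, y k ω < L ω + 1 / ((i : ℝ) + 1) :=
      eventually_lt_of_limsup_lt (by simp only [L]; linarith) hbdd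
    refine (h1.and_eventually h2).mono fun k hk => ?_
    change |y k ω - L ω| ≤ _
    rw [abs_le]
    constructor <;> linarith [hk.1, hk.2]
  have hle : ∀ i, dist (y (σ i ω) ω) (L ω) ≤ 1 / ((i : ℝ) + 1) := fun i => hmem ω hfr i
  exact tendsto_iff_dist_tendsto_zero.2
    (squeeze_zero (fun _ => dist_nonneg) hle tendsto_one_div_add_atTop_nhds_zero_nat)

/-- A measurable version of the Bolzano–Weierstrass theorem in `ℝⁿ`: coordinate by coordinate, one
passes to a random subsequence along which the coordinate converges. -/
theorem exists_measurable_convergent_subsequence {Ω : Type*} [MeasurableSpace Ω] {n : ℕ}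
    {y : ℕ → Ω → Pt n} (hy : ∀ k, Measurable (y k)) {R : ℝ} (hR : ∀ k ω, ‖y k ω‖ ≤ R) :
    ∃ (σ : ℕ → Ω → ℕ) (l : Ω → Pt n), (∀ i, Measurable (σ i)) ∧ Measurable l ∧
      (∀ ω, StrictMono fun i => σ i ω) ∧ ∀ ω, Tendsto (fun i => y (σ i ω) ω) atTop (𝓝 (l ω)) := by
  have key : ∀ s : Finset (Fin n), ∃ σ : ℕ → Ω → ℕ, (∀ i, Measurable (σ i)) ∧
      (∀ ω, StrictMono fun i => σ i ω) ∧
      ∀ j ∈ s, ∀ ω, ∃ l : ℝ, Tendsto (fun i => y (σ i ω) ω j) atTop (𝓝 l) := by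
    intro s
    induction s using Finset.induction_on with
    | empty => exact ⟨fun i _ => i, fun i => measurable_const, fun ω => strictMono_id, by simp⟩
    | insert a s _ ih =>
      obtain ⟨σ, hσ, hmono, hlim⟩ := ih
      obtain ⟨θ, hθ, hmono', hlim'⟩ := exists_measurable_strictMono_tendsto
        (y := fun i ω => y (σ i ω) ω a)
        (fun i => (measurable_pi_apply a).comp (measurable_eval_nat hy (hσ i)))
        (R := R) (fun i ω => (norm_le_pi_norm (y (σ i ω) ω) a).trans (hR _ ω))
      refine ⟨fun i ω => σ (θ i ω) ω, fun i => measurable_eval_nat hσ (hθ i),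
        fun ω => (hmono ω).comp (hmono' ω), fun j hj ω => ?_⟩
      rcases Finset.mem_insert.1 hj with rfl | hj
      · exact hlim' ω
      · obtain ⟨l, hl⟩ := hlim j hj ω
        exact ⟨l, hl.comp (hmono' ω).tendsto_atTop⟩
  obtain ⟨σ, hσ, hmono, hlim⟩ := key Finset.univ
  choose l hl using fun (ω : Ω) (j : Fin n) => hlim j (Finset.mem_univ j) ω
  have htend : ∀ ω, Tendsto (fun i => y (σ i ω) ω) atTop (𝓝 (l ω)) := fun ω =>
    tendsto_pi_nhds.2 (hl ω)
  exact ⟨σ, l, hσ, measurable_of_tendsto_metrizable (fun i => measurable_eval_nat hy (hσ i))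
    (tendsto_pi_nhds.2 htend), hmono, htend⟩

/-! ### Measurability of the process -/

theorem measurable_indicator_of_continuousOn {n : ℕ} {X : Set (Pt n)} (hX : MeasurableSet X)
    {g : Pt n → ℝ} (hg : ContinuousOn g X) : Measurable (X.indicator g) := by
  classical
  rw [← Set.piecewise_eq_indicator]
  exact hg.measurable_piecewise continuousOn_const hX

/-- A function that is continuous on `X` need not be measurable off `X`, but its composition with
a random point of `X` is. -/
theorem measurable_comp_of_continuousOn {Ω : Type*} {mΩ : MeasurableSpace Ω} {n : ℕ}
    {X : Set (Pt n)} (hX : MeasurableSet X) {g : Pt n → ℝ} (hg : ContinuousOn g X)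
    {y : Ω → Pt n} (hy : Measurable y) (hmem : ∀ ω, y ω ∈ X) : Measurable fun ω => g (y ω) := by
  have h := (measurable_indicator_of_continuousOn hX hg).comp hy
  convert h using 1
  funext ω
  simp [hmem ω]

namespace Run

variable {Ω : Type*} {n m p : ℕ} {X : Set (Pt n)} {A : Run Ω n m} {P : Params n p X}

theorem past_mono (A : Run Ω n m) {k l : ℕ} (h : k ≤ l) : A.past k ≤ A.past l :=
  iSup₂_le fun i hi => le_iSup₂_of_le i (hi.trans_le h) le_rfl

theorem measurable_C0_past (A : Run Ω n m) (k : ℕ) (i : Incumbent) (j : Fin m) :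
    Measurable[A.past (k + 1)] (A.C0 k i j) := by
  rw [measurable_iff_comap_le]
  refine le_trans ?_ (le_iSup₂ (f := fun (l : ℕ) (_ : l < k + 1) =>
    (⨆ c, MeasurableSpace.comap (A.F0 l c) inferInstance) ⊔
    (⨆ (c) (j), MeasurableSpace.comap (A.C0 l c j) inferInstance) ⊔
    (⨆ s, MeasurableSpace.comap (A.Fs l s) inferInstance) ⊔
    (⨆ (s) (j), MeasurableSpace.comap (A.Cs l s j) inferInstance)) k (Nat.lt_succ_self k))
  exact le_sup_of_le_left (le_sup_of_le_left (le_sup_of_le_right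
    (le_iSup₂ (f := fun c j => MeasurableSpace.comap (A.C0 k c j) inferInstance) i j)))

theorem measurable_Cs_past (A : Run Ω n m) (k : ℕ) (s : Incumbent × ℕ) (j : Fin m) :
    Measurable[A.past (k + 1)] (A.Cs k s j) := by
  rw [measurable_iff_comap_le]
  refine le_trans ?_ (le_iSup₂ (f := fun (l : ℕ) (_ : l < k + 1) =>
    (⨆ c, MeasurableSpace.comap (A.F0 l c) inferInstance) ⊔
    (⨆ (c) (j), MeasurableSpace.comap (A.C0 l c j) inferInstance) ⊔
    (⨆ s, MeasurableSpace.comap (A.Fs l s) inferInstance) ⊔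
    (⨆ (s) (j), MeasurableSpace.comap (A.Cs l s j) inferInstance)) k (Nat.lt_succ_self k))
  exact le_sup_of_le_right
    (le_iSup₂ (f := fun s j => MeasurableSpace.comap (A.Cs k s j) inferInstance) s j)

section

variable {mΩ : MeasurableSpace Ω}

theorem IsGenerated.past_le (hA : A.IsGenerated P) (k : ℕ) : A.past k ≤ mΩ :=
  iSup₂_le fun l _ => sup_le (sup_le (sup_le
    (iSup_le fun i => (hA.measurable_F0 l i).comap_le)
    (iSup₂_le fun i j => (hA.measurable_C0 l i j).comap_le))
    (iSup_le fun s => (hA.measurable_Fs l s).comap_le))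
    (iSup₂_le fun s j => (hA.measurable_Cs l s j).comap_le)

theorem IsGenerated.measurable_Δm (hA : A.IsGenerated P) (k : ℕ) :
    Measurable[A.past k] (A.Δm k) :=
  (hA.adapted_Δ k).min ((hA.adapted_Δ k).pow_const 2)

theorem IsGenerated.measurable_pt (hA : A.IsGenerated P) (k : ℕ) (s : Incumbent × ℕ) :
    Measurable[A.past k] (A.pt k s) :=
  (hA.adapted_x k s.1).add ((hA.measurable_Δm k).smul (hA.adapted_dir k s.1 s.2))

theorem IsGenerated.measurableSet_trial (hA : A.IsGenerated P) (hX : MeasurableSet X) (k : ℕ)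
    (s : Incumbent × ℕ) : MeasurableSet[A.past k] {ω | s ∈ A.trial X k ω} := by
  have h1 : MeasurableSet[A.past k] {ω | A.Active k s.1 ω} := by
    by_cases hs : s.1 = feas
    · simp only [Active, hs, forall_const]
      exact hA.adapted_flag k (measurableSet_singleton true)
    · simp [Active, hs]
  have h2 : MeasurableSet[A.past k] {ω | s.2 < A.num k s.1 ω} :=
    hA.adapted_num k s.1 (measurableSet_Ioi (a := s.2))
  exact h1.inter (h2.inter (hA.measurable_pt k s hX))

theorem IsGenerated.measurableSet_I (hA : A.IsGenerated P) (hX : MeasurableSet X)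
    (hx : ∀ k i ω, A.x k i ω ∈ X) {c : Fin m → Pt n → ℝ} (hc : ContinuousOn (violation c) X)
    (k : ℕ) : MeasurableSet[A.past (k + 1)] (A.I P c k) := by
  have hle := A.past_mono k.le_succ
  have hΔ : Measurable[A.past (k + 1)] fun ω => P.ε * A.Δ k ω ^ 2 :=
    (((hA.adapted_Δ k).mono hle le_rfl).pow_const 2).const_mul P.ε
  have hL0 : ∀ i, Measurable[A.past (k + 1)] (A.L0 P k i) := fun i =>
    Finset.measurable_sum _ fun j _ => ((A.measurable_C0_past k i j).sub hΔ).max measurable_const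
  have hU0 : ∀ i, Measurable[A.past (k + 1)] (A.U0 P k i) := fun i =>
    Finset.measurable_sum _ fun j _ => ((A.measurable_C0_past k i j).add hΔ).max measurable_const
  have hLs : ∀ s, Measurable[A.past (k + 1)] (A.Ls P k s) := fun s =>
    Finset.measurable_sum _ fun j _ => ((A.measurable_Cs_past k s j).sub hΔ).max measurable_const
  have hUs : ∀ s, Measurable[A.past (k + 1)] (A.Us P k s) := fun s =>
    Finset.measurable_sum _ fun j _ => ((A.measurable_Cs_past k s j).add hΔ).max measurable_const
  have hv : ∀ i, Measurable[A.past (k + 1)] fun ω => violation c (A.x k i ω) := fun i =>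
    measurable_comp_of_continuousOn hX hc ((hA.adapted_x k i).mono hle le_rfl) (hx k i)
  have hvs : ∀ s, Measurable[A.past (k + 1)] fun ω => X.indicator (violation c) (A.pt k s ω) :=
    fun s => (measurable_indicator_of_continuousOn hX hc).comp
      ((hA.measurable_pt k s).mono hle le_rfl)
  have hset : A.I P c k =
      (⋂ i, {ω | A.L0 P k i ω ≤ violation c (A.x k i ω)} ∩
        {ω | violation c (A.x k i ω) ≤ A.U0 P k i ω}) ∩
      ⋂ s, {ω | s ∈ A.trial X k ω}ᶜ ∪
        ({ω | A.Ls P k s ω ≤ X.indicator (violation c) (A.pt k s ω)} ∩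
          {ω | X.indicator (violation c) (A.pt k s ω) ≤ A.Us P k s ω}) := by
    ext ω
    simp only [I, Set.mem_ofPred_eq, Set.mem_inter_iff, Set.mem_iInter, Set.mem_union,
      Set.mem_compl_iff]
    refine and_congr Iff.rfl (forall_congr' fun s => ?_)
    by_cases hs : s ∈ A.trial X k ω
    · simp [hs, Set.indicator_of_mem hs.2.2]
    · simp [hs]
  rw [hset]
  exact (MeasurableSet.iInter fun i => (measurableSet_le (hL0 i) (hv i)).inter
      (measurableSet_le (hv i) (hU0 i))).inter
    (MeasurableSet.iInter fun s => (hle _ (hA.measurableSet_trial hX k s)).compl.union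
      ((measurableSet_le (hLs s) (hvs s)).inter (measurableSet_le (hvs s) (hUs s))))

/-! ### The poll size and the steps of the algorithm -/

/-- The four types of iterations, as far as they matter for the convergence analysis: either the
`ε`-feasible incumbent moves, or the `ε`-infeasible one moves to a point with a smaller estimated
violation, or nothing moves, the poll size shrinks, and no trial point around the `ε`-infeasible
incumbent has a sufficiently small estimated violation. -/
theorem IsGenerated.step_cases (hA : A.IsGenerated P) (k : ℕ) (ω : Ω) :
    ((∃ s, s ∈ A.trial X k ω ∧ A.FTest P k s ω ∧ A.x (k + 1) feas ω = A.pt k s ω) ∧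
      A.flag (k + 1) ω = true ∧ A.x (k + 1) inf ω = A.x k inf ω ∧
      A.Δ (k + 1) ω = min (P.τ⁻¹ * A.Δ k ω) (P.τ⁻¹ ^ P.zhat)) ∨
    ((∃ s, s ∈ A.trial X k ω ∧ A.ITest P k s ω ∧ A.x (k + 1) inf ω = A.pt k s ω) ∧
      A.flag (k + 1) ω = A.flag k ω ∧ A.x (k + 1) feas ω = A.x k feas ω ∧
      A.Δ (k + 1) ω = min (P.τ⁻¹ * A.Δ k ω) (P.τ⁻¹ ^ P.zhat)) ∨
    ((¬ ∃ s ∈ A.trial X k ω, A.ITest P k s ω) ∧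
      A.flag (k + 1) ω = A.flag k ω ∧ A.x (k + 1) feas ω = A.x k feas ω ∧
      A.x (k + 1) inf ω = A.x k inf ω ∧ A.Δ (k + 1) ω = P.τ * A.Δ k ω) := by
  by_cases hF : A.FDominating P k ω
  · obtain ⟨h1, ⟨s, hs, hs'⟩, h3, h4⟩ := hA.step_f k ω hF
    exact Or.inl ⟨⟨s, hs, hs'⟩, h3, h1, h4⟩
  by_cases hH : A.HDominating P k ω
  · obtain ⟨⟨s, hs, hs', hs''⟩, h2, h3, h4⟩ := hA.step_h k ω hH
    exact Or.inr (Or.inl ⟨⟨s, hs, hs'.1, hs''⟩, h3, h2, h4⟩)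
  by_cases hI : A.Improving P k ω
  · obtain ⟨⟨s, hs, hs', _, hs''⟩, h2, h3, h4⟩ := hA.step_improving k ω hI
    exact Or.inr (Or.inl ⟨⟨s, hs, hs', hs''⟩, h3, h2, h4⟩)
  · obtain ⟨h1, h2, h3, h4⟩ := hA.step_unsuccessful k ω ⟨hF, hH, hI⟩
    exact Or.inr (Or.inr ⟨fun h => hI ⟨hF, hH, h⟩, h3, h2, h1, h4⟩)

theorem one_le_inv_τ (P : Params n p X) : 1 ≤ P.τ⁻¹ :=
  (one_le_inv₀ P.τ_pos).2 P.τ_lt_one.le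

theorem IsGenerated.Δ_pos_and_le (hA : A.IsGenerated P) (k : ℕ) (ω : Ω) :
    0 < A.Δ k ω ∧ A.Δ k ω ≤ P.τ⁻¹ ^ P.zhat := by
  have hinv : 0 < P.τ⁻¹ := inv_pos.2 P.τ_pos
  induction k with
  | zero => rw [hA.init_Δ]; exact ⟨P.δ₀_pos, P.δ₀_le⟩
  | succ k ih =>
    have h1 : 0 < P.τ⁻¹ * A.Δ k ω := mul_pos hinv ih.1
    have h2 : 0 < P.τ⁻¹ ^ P.zhat := pow_pos hinv _
    have h3 : P.τ * A.Δ k ω ≤ A.Δ k ω := mul_le_of_le_one_left ih.1.le P.τ_lt_one.le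
    rcases hA.step_cases k ω with h | h | h
    · rw [h.2.2.2]; exact ⟨lt_min h1 h2, min_le_right _ _⟩
    · rw [h.2.2.2]; exact ⟨lt_min h1 h2, min_le_right _ _⟩
    · rw [h.2.2.2.2]; exact ⟨mul_pos P.τ_pos ih.1, h3.trans ih.2⟩

theorem IsGenerated.Δ_pos (hA : A.IsGenerated P) (k : ℕ) (ω : Ω) : 0 < A.Δ k ω :=
  (hA.Δ_pos_and_le k ω).1

theorem IsGenerated.Δ_le (hA : A.IsGenerated P) (k : ℕ) (ω : Ω) :
    A.Δ k ω ≤ P.τ⁻¹ ^ P.zhat :=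
  (hA.Δ_pos_and_le k ω).2

theorem IsGenerated.τ_mul_Δ_le (hA : A.IsGenerated P) (k : ℕ) (ω : Ω) :
    P.τ * A.Δ k ω ≤ A.Δ (k + 1) ω := by
  have h3 : P.τ * A.Δ k ω ≤ A.Δ k ω :=
    mul_le_of_le_one_left (hA.Δ_pos k ω).le P.τ_lt_one.le
  have h4 : A.Δ k ω ≤ P.τ⁻¹ * A.Δ k ω :=
    le_mul_of_one_le_left (hA.Δ_pos k ω).le (one_le_inv_τ P)
  have h5 : P.τ * A.Δ k ω ≤ min (P.τ⁻¹ * A.Δ k ω) (P.τ⁻¹ ^ P.zhat) :=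
    le_min (h3.trans h4) (h3.trans (hA.Δ_le k ω))
  rcases hA.step_cases k ω with h | h | h
  · rw [h.2.2.2]; exact h5
  · rw [h.2.2.2]; exact h5
  · rw [h.2.2.2.2]

/-- The poll size of a fixed iteration is bounded away from zero uniformly in the realization, so
that negative powers of it are admissible weights for conditional expectations. -/
theorem IsGenerated.τ_pow_mul_le_Δ (hA : A.IsGenerated P) (k : ℕ) (ω : Ω) :
    P.τ ^ k * P.δ₀ ≤ A.Δ k ω := by
  induction k with
  | zero => simp [hA.init_Δ]
  | succ k ih =>
    calc P.τ ^ (k + 1) * P.δ₀ = P.τ * (P.τ ^ k * P.δ₀) := by ring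
      _ ≤ P.τ * A.Δ k ω := mul_le_mul_of_nonneg_left ih P.τ_pos.le
      _ ≤ A.Δ (k + 1) ω := hA.τ_mul_Δ_le k ω

theorem IsGenerated.measurable_Δ (hA : A.IsGenerated P) (k : ℕ) : Measurable (A.Δ k) :=
  (hA.adapted_Δ k).mono (hA.past_le k) le_rfl

theorem IsGenerated.measurable_x (hA : A.IsGenerated P) (k : ℕ) (i : Incumbent) :
    Measurable (A.x k i) :=
  (hA.adapted_x k i).mono (hA.past_le k) le_rfl

theorem IsGenerated.integrable_Δ_pow {μ : Measure Ω} [IsFiniteMeasure μ] (hA : A.IsGenerated P)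
    (k q : ℕ) : Integrable (fun ω => A.Δ k ω ^ q) μ := by
  refine Integrable.of_bound ((hA.measurable_Δ k).pow_const q).aestronglyMeasurable
    ((P.τ⁻¹ ^ P.zhat) ^ q) (Eventually.of_forall fun ω => ?_)
  rw [Real.norm_of_nonneg (pow_nonneg (hA.Δ_pos k ω).le q)]
  exact pow_le_pow_left₀ (hA.Δ_pos k ω).le (hA.Δ_le k ω) q

/-! ### Integrated accuracy requirements -/

/-- A conditional bound for `Z` may be integrated against any bounded nonnegative weight that is
known at the beginning of the iteration. -/
theorem CondExpLe.integral_mul_le {μ : Measure Ω} [IsFiniteMeasure μ] (hA : A.IsGenerated P)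
    {k : ℕ} {Z B w : Ω → ℝ} (h : CondExpLe μ A k Z B) (hw : Measurable[A.past k] w)
    (hw0 : ∀ ω, 0 ≤ w ω) {C : ℝ} (hC : ∀ ω, w ω ≤ C) (hB : Integrable (fun ω => w ω * B ω) μ) :
    Integrable (fun ω => w ω * Z ω) μ ∧ ∫ ω, w ω * Z ω ∂μ ≤ ∫ ω, w ω * B ω ∂μ := by
  have hC' : ∀ ω, |w ω| ≤ C := fun ω => by rw [abs_of_nonneg (hw0 ω)]; exact hC ω
  have hw' : AEStronglyMeasurable w μ := (hw.mono (hA.past_le k) le_rfl).aestronglyMeasurable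
  refine ⟨h.1.bdd_mul hw' (Eventually.of_forall hC'), ?_⟩
  rw [← integral_mul_condExp_of_bound (hA.past_le k) hw hC' h.1]
  refine integral_mono_ae (integrable_condExp.bdd_mul hw' (Eventually.of_forall hC')) hB ?_
  filter_upwards [h.2] with ω hω
  exact mul_le_mul_of_nonneg_left hω (hw0 ω)

theorem CondProbGe.mul_integral_le {μ : Measure Ω} [IsFiniteMeasure μ] (hA : A.IsGenerated P)
    {k : ℕ} {E : Set Ω} {q : ℝ} (h : CondProbGe μ A k E q) {w : Ω → ℝ}
    (hw : Measurable[A.past k] w) (hw0 : ∀ ω, 0 ≤ w ω) {C : ℝ} (hC : ∀ ω, w ω ≤ C) :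
    q * ∫ ω, w ω ∂μ ≤ ∫ ω, E.indicator w ω ∂μ := by
  have hC' : ∀ ω, |w ω| ≤ C := fun ω => by rw [abs_of_nonneg (hw0 ω)]; exact hC ω
  have hw' : AEStronglyMeasurable w μ := (hw.mono (hA.past_le k) le_rfl).aestronglyMeasurable
  have hE : Integrable (E.indicator fun _ => (1 : ℝ)) μ :=
    (integrable_const (1 : ℝ)).indicator h.1
  have hwi : Integrable w μ := Integrable.of_bound hw' C (Eventually.of_forall hC')
  have heq : (fun ω => E.indicator w ω) = fun ω => w ω * E.indicator (fun _ => (1 : ℝ)) ω := by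
    funext ω
    by_cases hω : ω ∈ E <;> simp [hω]
  rw [heq, ← integral_mul_condExp_of_bound (hA.past_le k) hw hC' hE, ← integral_const_mul]
  refine integral_mono_ae (hwi.const_mul q)
    (integrable_condExp.bdd_mul hw' (Eventually.of_forall hC')) ?_
  filter_upwards [h.2] with ω hω
  rw [mul_comm]
  exact mul_le_mul_of_nonneg_left hω (hw0 ω)

end

end Run

/-! ### Expected decrease of the potential -/

/-- Measurable selection from a countable set. -/
theorem exists_measurable_choice {Ω S : Type*} [MeasurableSpace Ω] [MeasurableSpace S]
    [Countable S] [Nonempty S] {p : S → Ω → Prop} (hp : ∀ s, MeasurableSet {ω | p s ω}) :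
    ∃ σ : Ω → S, Measurable σ ∧ ∀ ω, (∃ s, p s ω) → p (σ ω) ω := by
  classical
  obtain ⟨e, he⟩ := exists_surjective_nat S
  have hex : ∀ ω, ∃ k, p (e k) ω ∨ ∀ k', ¬ p (e k') ω := by
    intro ω
    by_cases h : ∃ k, p (e k) ω
    · exact h.imp fun k hk => Or.inl hk
    · exact ⟨0, Or.inr fun k' hk' => h ⟨k', hk'⟩⟩
  have hmeas : Measurable fun ω => Nat.find (hex ω) := by
    refine measurable_find hex fun k => ?_
    have hset : {ω | p (e k) ω ∨ ∀ k', ¬ p (e k') ω} =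
        {ω | p (e k) ω} ∪ ⋂ k', {ω | p (e k') ω}ᶜ := by
      ext ω
      simp
    rw [hset]
    exact (hp _).union (MeasurableSet.iInter fun k' => (hp _).compl)
  refine ⟨fun ω => e (Nat.find (hex ω)), measurable_from_nat.comp hmeas, fun ω hω => ?_⟩
  rcases Nat.find_spec (hex ω) with h | h
  · exact h
  · obtain ⟨s, hs⟩ := hω
    obtain ⟨k, rfl⟩ := he s
    exact absurd hs (h k)

/-- The change `ν / θ * g + (1 - ν) * (D' ^ 2 - D ^ 2)` of the potential in a successful iteration,
where `g` is the change of the objective that was found to decrease, `e` the estimation error, and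
`r = τ⁻¹`. -/
theorem potential_change_le {ν γ θ τ D D' g e : ℝ} {good : Prop} [Decidable good]
    (hν : ν ∈ Set.Ioo (0 : ℝ) 1) (hτ0 : 0 < τ) (hγ : 2 < γ) (hθ : 0 < θ)
    (hνγ : 2 * (τ⁻¹ ^ 2 - 1) / (γ - 2) ≤ ν / (1 - ν)) (hD' : 0 ≤ D')
    (hDD' : D' ≤ τ⁻¹ * D) (he : 0 ≤ e) (hg : g ≤ -(γ * θ * D ^ 2) + e)
    (hgood : good → e ≤ 2 * θ * D ^ 2) :
    ν / θ * g + (1 - ν) * (D' ^ 2 - D ^ 2) ≤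
      -((1 - ν) * (1 - τ ^ 2) * D ^ 2) + (if good then 0 else (1 - ν) * (1 - τ ^ 2) * D ^ 2) +
        ν / θ * e := by
  obtain ⟨hν0, hν1⟩ := hν
  have hV : 0 < ν / θ := div_pos hν0 hθ
  have hVθ : ν / θ * θ = ν := div_mul_cancel₀ ν hθ.ne'
  have h1 : 2 * ((1 - ν) * (τ⁻¹ ^ 2 - 1)) ≤ ν * (γ - 2) := by
    rw [div_le_div_iff₀ (by linarith) (by linarith)] at hνγ
    linarith
  have hr : τ⁻¹ ^ 2 - 1 ≥ 1 - τ ^ 2 := by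
    have h2 : τ⁻¹ * τ = 1 := inv_mul_cancel₀ hτ0.ne'
    nlinarith [sq_nonneg (τ⁻¹ - τ)]
  have h3 : D' ^ 2 ≤ τ⁻¹ ^ 2 * D ^ 2 := by
    rw [← mul_pow]
    exact pow_le_pow_left₀ hD' hDD' 2
  have ha : 0 ≤ D ^ 2 := sq_nonneg D
  have h4 : (1 - ν) * (D' ^ 2 - D ^ 2) ≤ ν * (γ - 2) / 2 * D ^ 2 := by
    calc (1 - ν) * (D' ^ 2 - D ^ 2) ≤ (1 - ν) * (τ⁻¹ ^ 2 * D ^ 2 - D ^ 2) :=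
          mul_le_mul_of_nonneg_left (by linarith) (by linarith)
      _ = ((1 - ν) * (τ⁻¹ ^ 2 - 1)) * D ^ 2 := by ring
      _ ≤ (ν * (γ - 2) / 2) * D ^ 2 := mul_le_mul_of_nonneg_right (by linarith) ha
  have h5 : (1 - ν) * (1 - τ ^ 2) * D ^ 2 ≤ ν * (γ - 2) / 2 * D ^ 2 := by
    refine mul_le_mul_of_nonneg_right ?_ ha
    have : (1 - ν) * (1 - τ ^ 2) ≤ (1 - ν) * (τ⁻¹ ^ 2 - 1) :=
      mul_le_mul_of_nonneg_left hr (by linarith)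
    linarith
  have h6 : ν / θ * g ≤ -(ν * γ * D ^ 2) + ν / θ * e := by
    calc ν / θ * g ≤ ν / θ * (-(γ * θ * D ^ 2) + e) := mul_le_mul_of_nonneg_left hg hV.le
      _ = -((ν / θ * θ) * γ * D ^ 2) + ν / θ * e := by ring
      _ = _ := by rw [hVθ]
  have h7 : 0 ≤ ν * D ^ 2 := mul_nonneg hν0.le ha
  have h8 : 0 ≤ ν * (γ - 2) * D ^ 2 := mul_nonneg (mul_nonneg hν0.le (by linarith)) ha
  split_ifs with h
  · have h9 : ν / θ * g ≤ -(ν * (γ - 2) * D ^ 2) := by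
      calc ν / θ * g ≤ ν / θ * (-(γ * θ * D ^ 2) + 2 * θ * D ^ 2) :=
            mul_le_mul_of_nonneg_left (hg.trans (by linarith [hgood h])) hV.le
        _ = -((ν / θ * θ) * (γ - 2) * D ^ 2) := by ring
        _ = _ := by rw [hVθ]
    have h10 : 0 ≤ ν / θ * e := mul_nonneg hV.le he
    linarith
  · linarith

namespace Run

variable {Ω : Type*} {n m p : ℕ} {X : Set (Pt n)} {A : Run Ω n m} {P : Params n p X}

/-- The potential of the process at the beginning of iteration `k`. The value `B` stands for the
objective value of the `ε`-feasible incumbent as long as there is none. -/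
noncomputable def potential (A : Run Ω n m) (P : Params n p X) (f : Pt n → ℝ)
    (c : Fin m → Pt n → ℝ) (ν B : ℝ) (k : ℕ) (ω : Ω) : ℝ :=
  {ω | A.flag k ω = true}.indicator (fun ω => ν / P.ε * (f (A.x k feas ω) - B)) ω +
    ν / (m * P.ε) * violation c (A.x k inf ω) + (1 - ν) * A.Δ k ω ^ 2

theorem violation_nonneg (c : Fin m → Pt n → ℝ) (x : Pt n) : 0 ≤ violation c x :=
  Finset.sum_nonneg fun _ _ => le_max_right _ _

/-- Reliable bounds for the violation make its estimate accurate. -/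
theorem abs_sum_max_sub_le {u : Fin m → ℝ} {t v : ℝ} (ht : 0 ≤ t)
    (h1 : ∑ j, max (u j - t) 0 ≤ v) (h2 : v ≤ ∑ j, max (u j + t) 0) :
    |∑ j, max (u j) 0 - v| ≤ m * t := by
  have key : ∀ w : Fin m → ℝ, ∑ j, max (w j + t) 0 ≤ ∑ j, max (w j) 0 + m * t := by
    intro w
    calc ∑ j, max (w j + t) 0 ≤ ∑ j, (max (w j) 0 + t) := by
          refine Finset.sum_le_sum fun j _ => max_le ?_ ?_
          · linarith [le_max_left (w j) 0]
          · linarith [le_max_right (w j) 0]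
      _ = _ := by simp [Finset.sum_add_distrib]
  have h3 := key u
  have h4 := key fun j => u j - t
  simp only [sub_add_cancel] at h4
  rw [abs_le]
  constructor <;> linarith

theorem abs_H0_sub_le {c : Fin m → Pt n → ℝ} {k : ℕ} {ω : Ω} (hI : ω ∈ A.I P c k)
    (i : Incumbent) :
    |A.H0 k i ω - violation c (A.x k i ω)| ≤ m * (P.ε * A.Δ k ω ^ 2) :=
  abs_sum_max_sub_le (mul_nonneg P.ε_pos.le (sq_nonneg _)) (hI.1 i).1 (hI.1 i).2

theorem abs_Hs_sub_le {c : Fin m → Pt n → ℝ} {k : ℕ} {ω : Ω} (hI : ω ∈ A.I P c k)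
    {s : Incumbent × ℕ} (hs : s ∈ A.trial X k ω) :
    |A.Hs k s ω - violation c (A.pt k s ω)| ≤ m * (P.ε * A.Δ k ω ^ 2) :=
  abs_sum_max_sub_le (mul_nonneg P.ε_pos.le (sq_nonneg _)) (hI.2 s hs).1 (hI.2 s hs).2

/-- The trial point `s` passes the test of an `f`-Dominating iteration, and the next `ε`-feasible
incumbent lies there. -/
def MovesFeas (A : Run Ω n m) (P : Params n p X) (k : ℕ) (s : Incumbent × ℕ) (ω : Ω) : Prop :=
  s ∈ A.trial X k ω ∧ A.FTest P k s ω ∧ A.x (k + 1) feas ω = A.pt k s ω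

/-- The trial point `s` satisfies the sufficient decrease of the estimated violation, and the next
`ε`-infeasible incumbent lies there. -/
def MovesInf (A : Run Ω n m) (P : Params n p X) (k : ℕ) (s : Incumbent × ℕ) (ω : Ω) : Prop :=
  s ∈ A.trial X k ω ∧ A.ITest P k s ω ∧ A.x (k + 1) inf ω = A.pt k s ω

/-- The error of the estimate of `f` at the trial point `σ`, zero where `σ` is no trial point. -/
noncomputable def errFs (A : Run Ω n m) (X : Set (Pt n)) (f : Pt n → ℝ) (k : ℕ)
    (σ : Ω → Incumbent × ℕ) (ω : Ω) : ℝ :=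
  {ω | σ ω ∈ A.trial X k ω}.indicator (fun ω => |A.Fs k (σ ω) ω - f (A.pt k (σ ω) ω)|) ω

/-- The error of the estimated violation at the trial point `σ`, zero where `σ` is no trial
point. -/
noncomputable def errHs (A : Run Ω n m) (X : Set (Pt n)) (c : Fin m → Pt n → ℝ) (k : ℕ)
    (σ : Ω → Incumbent × ℕ) (ω : Ω) : ℝ :=
  {ω | σ ω ∈ A.trial X k ω}.indicator
    (fun ω => |A.Hs k (σ ω) ω - violation c (A.pt k (σ ω) ω)|) ω

theorem errFs_nonneg (A : Run Ω n m) (X : Set (Pt n)) (f : Pt n → ℝ) (k : ℕ)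
    (σ : Ω → Incumbent × ℕ) (ω : Ω) : 0 ≤ A.errFs X f k σ ω :=
  Set.indicator_nonneg (fun _ _ => abs_nonneg _) ω

theorem errHs_nonneg (A : Run Ω n m) (X : Set (Pt n)) (c : Fin m → Pt n → ℝ) (k : ℕ)
    (σ : Ω → Incumbent × ℕ) (ω : Ω) : 0 ≤ A.errHs X c k σ ω :=
  Set.indicator_nonneg (fun _ _ => abs_nonneg _) ω

variable {mΩ : MeasurableSpace Ω}

/-- The change of the potential in one iteration. Unless the estimates that led to a success were
inaccurate, the potential decreases by a multiple of `Δ ^ 2`; otherwise it increases by at most a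
multiple of the errors. The first `ε`-feasible point decreases it because `B` is large. -/
theorem potential_succ_le (hm : 0 < m) (hA : A.IsGenerated P) {f : Pt n → ℝ}
    {c : Fin m → Pt n → ℝ} {ν B : ℝ} (hν : ν ∈ Set.Ioo (0 : ℝ) 1)
    (hνγ : 2 * (P.τ⁻¹ ^ 2 - 1) / (P.γ - 2) ≤ ν / (1 - ν)) (k : ℕ) (ω : Ω)
    (hB : ν / P.ε * (f (A.x (k + 1) feas ω) - B) + 2 * (P.τ⁻¹ ^ P.zhat) ^ 2 ≤ 0)
    {σ ρ : Ω → Incumbent × ℕ} (hσ : (∃ s, A.MovesFeas P k s ω) → A.MovesFeas P k (σ ω) ω)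
    (hρ : (∃ s, A.MovesInf P k s ω) → A.MovesInf P k (ρ ω) ω) :
    A.potential P f c ν B (k + 1) ω ≤ A.potential P f c ν B k ω -
      (1 - ν) * (1 - P.τ ^ 2) * A.Δ k ω ^ 2 +
      (A.J P f k)ᶜ.indicator (fun ω => (1 - ν) * (1 - P.τ ^ 2) * A.Δ k ω ^ 2) ω +
      (A.I P c k)ᶜ.indicator (fun ω => (1 - ν) * (1 - P.τ ^ 2) * A.Δ k ω ^ 2) ω +
      ν / P.ε * (A.errFs X f k σ ω + |A.F0 k feas ω - f (A.x k feas ω)|) +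
      ν / (m * P.ε) * (A.errHs X c k ρ ω + |A.H0 k inf ω - violation c (A.x k inf ω)|) := by
  classical
  have hm' : (0 : ℝ) < m := by exact_mod_cast hm
  have hτ := P.τ_pos
  have hε := P.ε_pos
  have hτ2 : P.τ ^ 2 < 1 := pow_lt_one₀ hτ.le P.τ_lt_one two_ne_zero
  have hκ0 : 0 ≤ (1 - ν) * (1 - P.τ ^ 2) := mul_nonneg (by linarith [hν.2]) (by linarith)
  have hκ1 : (1 - ν) * (1 - P.τ ^ 2) ≤ 1 :=
    mul_le_one₀ (by linarith [hν.1]) (by linarith) (by linarith [sq_nonneg P.τ])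
  have hD := hA.Δ_pos k ω
  have hD' := hA.Δ_pos (k + 1) ω
  have hJ0 : 0 ≤ (A.J P f k)ᶜ.indicator
      (fun ω => (1 - ν) * (1 - P.τ ^ 2) * A.Δ k ω ^ 2) ω :=
    Set.indicator_nonneg (fun _ _ => mul_nonneg hκ0 (sq_nonneg _)) ω
  have hI0 : 0 ≤ (A.I P c k)ᶜ.indicator
      (fun ω => (1 - ν) * (1 - P.τ ^ 2) * A.Δ k ω ^ 2) ω :=
    Set.indicator_nonneg (fun _ _ => mul_nonneg hκ0 (sq_nonneg _)) ω
  have hF0 : 0 ≤ ν / P.ε * (A.errFs X f k σ ω + |A.F0 k feas ω - f (A.x k feas ω)|) :=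
    mul_nonneg (div_pos hν.1 hε).le (add_nonneg (errFs_nonneg ..) (abs_nonneg _))
  have hH0 : 0 ≤ ν / (m * P.ε) *
      (A.errHs X c k ρ ω + |A.H0 k inf ω - violation c (A.x k inf ω)|) :=
    mul_nonneg (div_pos hν.1 (mul_pos hm' hε)).le (add_nonneg (errHs_nonneg ..) (abs_nonneg _))
  rcases hA.step_cases k ω with ⟨hex, hfl, hx, hΔ⟩ | ⟨hex, hfl, hx, hΔ⟩ | ⟨-, hfl, hx, hx', hΔ⟩
  · have hinf : A.Δ (k + 1) ω ≤ P.τ⁻¹ * A.Δ k ω := hΔ.trans_le (min_le_left _ _)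
    by_cases hflk : A.flag k ω = true
    · -- The `ε`-feasible incumbent is replaced by a better one.
      obtain ⟨hs, ht, hpt⟩ := hσ hex
      have hJe : A.errFs X f k σ ω = |A.Fs k (σ ω) ω - f (A.pt k (σ ω) ω)| :=
        Set.indicator_of_mem (s := {ω | σ ω ∈ A.trial X k ω}) hs _
      have h := potential_change_le (good := ω ∈ A.J P f k) (γ := P.γ) (D := A.Δ k ω)
        (D' := A.Δ (k + 1) ω)
        (g := f (A.pt k (σ ω) ω) - f (A.x k feas ω))
        (e := A.errFs X f k σ ω + |A.F0 k feas ω - f (A.x k feas ω)|)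
        hν hτ P.two_lt_γ hε hνγ hD'.le hinf (add_nonneg (errFs_nonneg ..) (abs_nonneg _))
        (by
          have h1 := ht.2 hflk
          rw [hJe]
          have h2 := neg_abs_le (A.Fs k (σ ω) ω - f (A.pt k (σ ω) ω))
          have h3 := le_abs_self (A.F0 k feas ω - f (A.x k feas ω))
          linarith)
        (fun hJ => by
          rw [hJe]
          have h1 := hJ.1 feas
          have h2 := hJ.2 _ hs
          linarith)
      have hite : (if ω ∈ A.J P f k then 0 else (1 - ν) * (1 - P.τ ^ 2) * A.Δ k ω ^ 2) =
          (A.J P f k)ᶜ.indicator (fun ω => (1 - ν) * (1 - P.τ ^ 2) * A.Δ k ω ^ 2) ω := by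
        by_cases hJ : ω ∈ A.J P f k <;> simp [hJ]
      rw [hite] at h
      simp only [potential, Set.indicator, Set.mem_ofPred_eq, hfl, hflk, if_true, hx, hpt] at h ⊢
      simp only [Set.indicator] at hJ0 hI0
      linarith
    · -- A first `ε`-feasible incumbent appears: its objective value replaces `B`.
      have h1 : A.Δ (k + 1) ω ^ 2 ≤ (P.τ⁻¹ ^ P.zhat) ^ 2 :=
        pow_le_pow_left₀ hD'.le (hA.Δ_le _ ω) 2
      have h2 : A.Δ k ω ^ 2 ≤ (P.τ⁻¹ ^ P.zhat) ^ 2 := pow_le_pow_left₀ hD.le (hA.Δ_le _ ω) 2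
      have h3 : (1 - ν) * A.Δ (k + 1) ω ^ 2 ≤ (P.τ⁻¹ ^ P.zhat) ^ 2 :=
        (mul_le_of_le_one_left (sq_nonneg _) (by linarith [hν.1])).trans h1
      have h4 : (1 - ν) * (1 - P.τ ^ 2) * A.Δ k ω ^ 2 ≤ (P.τ⁻¹ ^ P.zhat) ^ 2 :=
        (mul_le_of_le_one_left (sq_nonneg _) hκ1).trans h2
      have h5 : 0 ≤ (1 - ν) * A.Δ k ω ^ 2 := mul_nonneg (by linarith [hν.2]) (sq_nonneg _)
      have e1 : A.potential P f c ν B (k + 1) ω = ν / P.ε * (f (A.x (k + 1) feas ω) - B) +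
          ν / (m * P.ε) * violation c (A.x k inf ω) + (1 - ν) * A.Δ (k + 1) ω ^ 2 := by
        simp [potential, hfl, hx]
      have e2 : A.potential P f c ν B k ω =
          ν / (m * P.ε) * violation c (A.x k inf ω) + (1 - ν) * A.Δ k ω ^ 2 := by
        simp [potential, hflk]
      linarith
  · -- The `ε`-infeasible incumbent is replaced by a better one.
    have hinf : A.Δ (k + 1) ω ≤ P.τ⁻¹ * A.Δ k ω := hΔ.trans_le (min_le_left _ _)
    obtain ⟨hs, ht, hpt⟩ := hρ hex
    have hIe : A.errHs X c k ρ ω = |A.Hs k (ρ ω) ω - violation c (A.pt k (ρ ω) ω)| :=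
      Set.indicator_of_mem (s := {ω | ρ ω ∈ A.trial X k ω}) hs _
    have h := potential_change_le (good := ω ∈ A.I P c k) (γ := P.γ) (D := A.Δ k ω)
      (D' := A.Δ (k + 1) ω)
      (g := violation c (A.pt k (ρ ω) ω) - violation c (A.x k inf ω))
      (e := A.errHs X c k ρ ω + |A.H0 k inf ω - violation c (A.x k inf ω)|)
      hν hτ P.two_lt_γ (mul_pos hm' hε) hνγ hD'.le hinf
      (add_nonneg (errHs_nonneg ..) (abs_nonneg _))
      (by
        have h1 := ht.2
        rw [hIe]
        have h2 := neg_abs_le (A.Hs k (ρ ω) ω - violation c (A.pt k (ρ ω) ω))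
        have h3 := le_abs_self (A.H0 k inf ω - violation c (A.x k inf ω))
        linarith)
      (fun hI => by
        rw [hIe]
        have h1 := abs_H0_sub_le hI inf
        have h2 := abs_Hs_sub_le hI hs
        linarith)
    have hite : (if ω ∈ A.I P c k then 0 else (1 - ν) * (1 - P.τ ^ 2) * A.Δ k ω ^ 2) =
        (A.I P c k)ᶜ.indicator (fun ω => (1 - ν) * (1 - P.τ ^ 2) * A.Δ k ω ^ 2) ω := by
      by_cases hI : ω ∈ A.I P c k <;> simp [hI]
    rw [hite] at h
    simp only [potential, Set.indicator, Set.mem_ofPred_eq, hfl, hx, hpt] at h ⊢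
    simp only [Set.indicator] at hJ0 hI0
    linarith
  · have e1 : A.potential P f c ν B (k + 1) ω = A.potential P f c ν B k ω -
        (1 - ν) * (1 - P.τ ^ 2) * A.Δ k ω ^ 2 := by
      simp only [potential, Set.indicator, Set.mem_ofPred_eq, hfl, hx, hx', hΔ]
      ring
    linarith

end Run

namespace Run

/-! ### Vanishing of the poll size -/

variable {Ω : Type*} {n m p : ℕ} {X : Set (Pt n)} {A : Run Ω n m} {P : Params n p X}
  {mΩ : MeasurableSpace Ω} {μ : Measure Ω}

/-- A second moment bound of order `Δ ^ 4` gives a first moment bound of order `Δ ^ 2`, by the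
inequality `e ≤ e ^ 2 / (2 t) + t / 2` with `t = √(1 - β) * ε * Δ ^ 2`. -/
theorem CondExpLe.exists_integral_le_of_sq [IsFiniteMeasure μ] (hA : A.IsGenerated P) {β : ℝ}
    (hβ : β ∈ Set.Ioo (0 : ℝ) 1) {k : ℕ} {e : Ω → ℝ}
    (h : CondExpLe μ A k (fun ω => e ω ^ 2) fun ω => P.ε ^ 2 * (1 - √β) * A.Δ k ω ^ 4) :
    ∃ Q : Ω → ℝ, Integrable Q μ ∧ (∀ ω, e ω ≤ Q ω) ∧
      ∫ ω, Q ω ∂μ ≤ √(1 - β) * P.ε * ∫ ω, A.Δ k ω ^ 2 ∂μ := by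
  have hε := P.ε_pos
  set q := √(1 - β) with hq
  have hq0 : 0 < q := Real.sqrt_pos.2 (by linarith [hβ.2])
  have hq2 : 1 - √β ≤ q ^ 2 := by
    rw [hq, Real.sq_sqrt (by linarith [hβ.2])]
    have : β ≤ √β := Real.le_sqrt_of_sq_le (by nlinarith [hβ.1, hβ.2])
    linarith
  have hD := fun ω => hA.Δ_pos k ω
  let w : Ω → ℝ := fun ω => (2 * (q * P.ε * A.Δ k ω ^ 2))⁻¹
  have hw : Measurable[A.past k] w :=
    (((((hA.adapted_Δ k).pow_const 2).const_mul (q * P.ε)).const_mul 2)).inv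
  have hw0 : ∀ ω, 0 ≤ w ω := fun ω => by
    have := hD ω
    positivity
  have hlow : 0 < P.τ ^ k * P.δ₀ := mul_pos (pow_pos P.τ_pos k) P.δ₀_pos
  have hwC : ∀ ω, w ω ≤ (2 * (q * P.ε * (P.τ ^ k * P.δ₀) ^ 2))⁻¹ := fun ω => by
    have h1 := hA.τ_pow_mul_le_Δ k ω
    have h2 : (P.τ ^ k * P.δ₀) ^ 2 ≤ A.Δ k ω ^ 2 := pow_le_pow_left₀ hlow.le h1 2
    refine inv_anti₀ (by positivity) ?_
    gcongr
  have hwB : (fun ω => w ω * (P.ε ^ 2 * (1 - √β) * A.Δ k ω ^ 4)) =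
      fun ω => P.ε * (1 - √β) / (2 * q) * A.Δ k ω ^ 2 := by
    funext ω
    have := (hD ω).ne'
    simp only [w]
    field_simp
  have hi2 := hA.integrable_Δ_pow (μ := μ) k 2
  obtain ⟨hint, hle⟩ := h.integral_mul_le hA hw hw0 hwC (by
    rw [hwB]
    exact hi2.const_mul _)
  refine ⟨fun ω => w ω * e ω ^ 2 + q * P.ε / 2 * A.Δ k ω ^ 2, hint.add (hi2.const_mul _),
    fun ω => ?_, ?_⟩
  · have ht : 0 < q * P.ε * A.Δ k ω ^ 2 := by
      have := hD ω
      positivity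
    have h3 : w ω * e ω ^ 2 + q * P.ε / 2 * A.Δ k ω ^ 2 - e ω =
        w ω * (e ω - q * P.ε * A.Δ k ω ^ 2) ^ 2 := by
      have := (hD ω).ne'
      simp only [w]
      field_simp
      ring
    linarith [mul_nonneg (hw0 ω) (sq_nonneg (e ω - q * P.ε * A.Δ k ω ^ 2))]
  · rw [integral_add hint (hi2.const_mul _), integral_const_mul]
    rw [hwB, integral_const_mul] at hle
    have h0 : 0 ≤ ∫ ω, A.Δ k ω ^ 2 ∂μ := integral_nonneg fun ω => sq_nonneg _
    have h4 : P.ε * (1 - √β) / (2 * q) ≤ q * P.ε / 2 := by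
      rw [div_le_div_iff₀ (by positivity) (by norm_num)]
      nlinarith
    have h5 := mul_le_mul_of_nonneg_right h4 h0
    have h6 : q * P.ε * ∫ ω, A.Δ k ω ^ 2 ∂μ =
      q * P.ε / 2 * ∫ ω, A.Δ k ω ^ 2 ∂μ + q * P.ε / 2 * ∫ ω, A.Δ k ω ^ 2 ∂μ := by ring
    rw [h6]
    linarith

theorem CondExpLe.integral_le [IsFiniteMeasure μ] (hA : A.IsGenerated P) {k : ℕ} {e : Ω → ℝ}
    {C : ℝ} (h : CondExpLe μ A k e fun ω => C * A.Δ k ω ^ 2) :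
    ∫ ω, e ω ∂μ ≤ C * ∫ ω, A.Δ k ω ^ 2 ∂μ := by
  have h1 := (h.integral_mul_le hA (w := fun _ => 1) measurable_const (fun _ => zero_le_one)
    (fun _ => le_rfl) (by simpa using (hA.integrable_Δ_pow (μ := μ) k 2).const_mul C)).2
  simpa [integral_const_mul] using h1

/-- The expectation of `w` on the complement of an event of conditional probability at least
`q`. -/
theorem CondProbGe.integral_compl_le [IsFiniteMeasure μ] (hA : A.IsGenerated P)
    {k : ℕ} {E : Set Ω} {q : ℝ} (h : CondProbGe μ A k E q) {w : Ω → ℝ}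
    (hw : Measurable[A.past k] w) (hw0 : ∀ ω, 0 ≤ w ω) {C : ℝ} (hC : ∀ ω, w ω ≤ C) :
    Integrable (Eᶜ.indicator w) μ ∧ ∫ ω, Eᶜ.indicator w ω ∂μ ≤ (1 - q) * ∫ ω, w ω ∂μ := by
  have hC' : ∀ ω, |w ω| ≤ C := fun ω => by rw [abs_of_nonneg (hw0 ω)]; exact hC ω
  have hwi : Integrable w μ := Integrable.of_bound
    (hw.mono (hA.past_le k) le_rfl).aestronglyMeasurable C (Eventually.of_forall hC')
  refine ⟨hwi.indicator h.1.compl, ?_⟩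
  have h1 := h.mul_integral_le hA hw hw0 hC
  have h2 : ∫ ω, Eᶜ.indicator w ω ∂μ = ∫ ω, w ω ∂μ - ∫ ω, E.indicator w ω ∂μ := by
    rw [← integral_sub hwi (hwi.indicator h.1)]
    congr 1
    funext ω
    by_cases hω : ω ∈ E <;> simp [hω]
  rw [h2]
  linarith

theorem IsGenerated.measurableSet_movesFeas (hA : A.IsGenerated P) (hX : MeasurableSet X) (k : ℕ)
    (s : Incumbent × ℕ) : MeasurableSet {ω | A.MovesFeas P k s ω} := by
  have hΔ := (hA.measurable_Δ k).pow_const 2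
  have hpt := (hA.measurable_pt k s).mono (hA.past_le k) le_rfl
  have hU : Measurable (A.Us P k s) := Finset.measurable_sum _ fun j _ =>
    ((hA.measurable_Cs k s j).add (hΔ.const_mul P.ε)).max measurable_const
  have hF : MeasurableSet {ω | A.FTest P k s ω} := by
    refine (hU (measurableSet_singleton 0)).inter ?_
    have h1 : MeasurableSet {ω | A.flag k ω = true} :=
      (hA.past_le k) _ (hA.adapted_flag k (measurableSet_singleton true))
    have h2 : MeasurableSet {ω | A.Fs k s ω - A.F0 k feas ω ≤ -(P.γ * P.ε * A.Δ k ω ^ 2)} :=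
      measurableSet_le ((hA.measurable_Fs k s).sub (hA.measurable_F0 k feas))
        ((hΔ.const_mul _).neg)
    have h3 : {ω | A.flag k ω = true →
        A.Fs k s ω - A.F0 k feas ω ≤ -(P.γ * P.ε * A.Δ k ω ^ 2)} =
        {ω | A.flag k ω = true}ᶜ ∪
          {ω | A.Fs k s ω - A.F0 k feas ω ≤ -(P.γ * P.ε * A.Δ k ω ^ 2)} := by
      ext ω
      simp only [Set.mem_ofPred_eq, Set.mem_union, Set.mem_compl_iff]
      tauto
    change MeasurableSet {ω | A.flag k ω = true → _}
    rw [h3]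
    exact h1.compl.union h2
  exact ((hA.past_le k) _ (hA.measurableSet_trial hX k s)).inter
    (hF.inter (measurableSet_eq_fun (hA.measurable_x (k + 1) feas) hpt))

theorem IsGenerated.measurableSet_movesInf (hA : A.IsGenerated P) (hX : MeasurableSet X) (k : ℕ)
    (s : Incumbent × ℕ) : MeasurableSet {ω | A.MovesInf P k s ω} := by
  have hΔ := (hA.measurable_Δ k).pow_const 2
  have hpt := (hA.measurable_pt k s).mono (hA.past_le k) le_rfl
  have hHs : Measurable (A.Hs k s) := Finset.measurable_sum _ fun j _ =>
    (hA.measurable_Cs k s j).max measurable_const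
  have hH0 : Measurable (A.H0 k inf) := Finset.measurable_sum _ fun j _ =>
    (hA.measurable_C0 k inf j).max measurable_const
  have hF : MeasurableSet {ω | A.ITest P k s ω} :=
    (MeasurableSet.const _).inter (measurableSet_le (hHs.sub hH0) ((hΔ.const_mul _).neg))
  exact ((hA.past_le k) _ (hA.measurableSet_trial hX k s)).inter
    (hF.inter (measurableSet_eq_fun (hA.measurable_x (k + 1) inf) hpt))

theorem IsGenerated.integrable_comp_x [IsFiniteMeasure μ] (hA : A.IsGenerated P)
    (hX : MeasurableSet X) {U : Set (Pt n)} (hU : IsCompact U) (hUX : U ⊆ X)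
    (hAU : ∀ k i ω, A.x k i ω ∈ U) {g : Pt n → ℝ} (hg : ContinuousOn g X) (k : ℕ)
    (i : Incumbent) : Integrable (fun ω => g (A.x k i ω)) μ := by
  obtain ⟨C, hC⟩ := hU.exists_bound_of_continuousOn (hg.mono hUX)
  exact Integrable.of_bound (measurable_comp_of_continuousOn hX hg (hA.measurable_x k i)
    fun ω => hUX (hAU k i ω)).aestronglyMeasurable C
    (Eventually.of_forall fun ω => hC _ (hAU k i ω))

theorem IsGenerated.integrable_potential [IsFiniteMeasure μ] (hA : A.IsGenerated P)
    (hX : MeasurableSet X) {U : Set (Pt n)} (hU : IsCompact U) (hUX : U ⊆ X)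
    (hAU : ∀ k i ω, A.x k i ω ∈ U) {f : Pt n → ℝ} (hf : ContinuousOn f X)
    {c : Fin m → Pt n → ℝ} (hc : ContinuousOn (violation c) X) (ν B : ℝ) (k : ℕ) :
    Integrable (A.potential P f c ν B k) μ := by
  have h1 : MeasurableSet {ω | A.flag k ω = true} :=
    (hA.past_le k) _ (hA.adapted_flag k (measurableSet_singleton true))
  exact ((((hA.integrable_comp_x hX hU hUX hAU hf k feas).sub (integrable_const B)).const_mul
    (ν / P.ε)).indicator h1).add ((hA.integrable_comp_x hX hU hUX hAU hc k inf).const_mul _)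
    |>.add ((hA.integrable_Δ_pow k 2).const_mul _)

/-- The expected potential decreases by a multiple of the second moment of the poll size. No
independence of `I` and `J` is needed: the probability that one of them fails is at most
`(1 - α) + (1 - β)`, and `α + β - 1 > α * β / 2`. -/
theorem integral_potential_succ_le [IsProbabilityMeasure μ] (hm : 0 < m) (hA : A.IsGenerated P)
    (hX : MeasurableSet X) {U : Set (Pt n)} (hU : IsCompact U) (hUX : U ⊆ X)
    (hAU : ∀ k i ω, A.x k i ω ∈ U) {f : Pt n → ℝ} (hf : ContinuousOn f X)
    {c : Fin m → Pt n → ℝ} (hc : ContinuousOn (violation c) X) {ν α β B : ℝ}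
    (hν : ν ∈ Set.Ioo (0 : ℝ) 1) (hβ : β ∈ Set.Ioo (0 : ℝ) 1)
    (hνγ : 2 * (P.τ⁻¹ ^ 2 - 1) / (P.γ - 2) ≤ ν / (1 - ν))
    (hαβ : 4 * ν / ((1 - ν) * (1 - P.τ ^ 2)) * (√(1 - α) + 2 * √(1 - β)) ≤ α * β)
    (hacc : A.Accurate μ P f c α β)
    (hB : ∀ x ∈ U, ν / P.ε * (f x - B) + 2 * (P.τ⁻¹ ^ P.zhat) ^ 2 ≤ 0) (k : ℕ) :
    ∫ ω, A.potential P f c ν B (k + 1) ω ∂μ ≤ ∫ ω, A.potential P f c ν B k ω ∂μ -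
      (1 - ν) * (1 - P.τ ^ 2) * (α + β - 1 - α * β / 2) * ∫ ω, A.Δ k ω ^ 2 ∂μ := by
  have hm' : (0 : ℝ) < m := by exact_mod_cast hm
  have hε := P.ε_pos
  have hτ2 : P.τ ^ 2 < 1 := pow_lt_one₀ P.τ_pos.le P.τ_lt_one two_ne_zero
  set κ := (1 - ν) * (1 - P.τ ^ 2) with hκ
  have hκ0 : 0 < κ := mul_pos (by linarith [hν.2]) (by linarith)
  obtain ⟨σ, hσm, hσ⟩ := exists_measurable_choice (hA.measurableSet_movesFeas hX k)
  obtain ⟨ρ, hρm, hρ⟩ := exists_measurable_choice (hA.measurableSet_movesInf hX k)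
  have hFs : (fun ω => A.errFs X f k σ ω ^ 2) = {ω | σ ω ∈ A.trial X k ω}.indicator
      (fun ω => |A.Fs k (σ ω) ω - f (A.pt k (σ ω) ω)| ^ 2) := by
    funext ω
    by_cases h : σ ω ∈ A.trial X k ω <;> simp [errFs, Set.indicator, h]
  obtain ⟨Qs, hQs, hQs', hQs''⟩ := CondExpLe.exists_integral_le_of_sq hA hβ
    (hFs ▸ hacc.var_fs k σ hσm)
  obtain ⟨Q0, hQ0, hQ0', hQ0''⟩ := CondExpLe.exists_integral_le_of_sq hA hβ (hacc.var_f0 k feas)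
  have hHs' : Integrable (A.errHs X c k ρ) μ := (hacc.mean_hs k ρ hρm).1
  have hHs : ∫ ω, A.errHs X c k ρ ω ∂μ ≤ m * P.ε * √(1 - α) * ∫ ω, A.Δ k ω ^ 2 ∂μ :=
    (hacc.mean_hs k ρ hρm).integral_le hA
  have hH0' := (hacc.mean_h0 k inf).1
  have hH0 := (hacc.mean_h0 k inf).integral_le hA
  have hwm : Measurable[A.past k] fun ω => κ * A.Δ k ω ^ 2 :=
    ((hA.adapted_Δ k).pow_const 2).const_mul κ
  have hw0 : ∀ ω, 0 ≤ κ * A.Δ k ω ^ 2 := fun ω => mul_nonneg hκ0.le (sq_nonneg _)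
  have hwC : ∀ ω, κ * A.Δ k ω ^ 2 ≤ κ * (P.τ⁻¹ ^ P.zhat) ^ 2 := fun ω =>
    mul_le_mul_of_nonneg_left (pow_le_pow_left₀ (hA.Δ_pos k ω).le (hA.Δ_le k ω) 2) hκ0.le
  obtain ⟨hJ', hJ⟩ := (hacc.prob_f k).integral_compl_le hA hwm hw0 hwC
  obtain ⟨hI', hI⟩ := (hacc.prob_bounds k).integral_compl_le hA hwm hw0 hwC
  rw [integral_const_mul] at hJ hI
  have hΦ := hA.integrable_potential (μ := μ) hX hU hUX hAU hf hc ν B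
  have hi2 : Integrable (fun ω => κ * A.Δ k ω ^ 2) μ :=
    (hA.integrable_Δ_pow (μ := μ) k 2).const_mul κ
  have hV : 0 < ν / P.ε := div_pos hν.1 hε
  have hQ : Integrable (fun ω => ν / P.ε * (Qs ω + Q0 ω)) μ := (hQs.add hQ0).const_mul _
  have hH : Integrable (fun ω => ν / (m * P.ε) * (A.errHs X c k ρ ω +
      |A.H0 k inf ω - violation c (A.x k inf ω)|)) μ := (hHs'.add hH0').const_mul _
  have i1 : Integrable (fun ω => A.potential P f c ν B k ω - κ * A.Δ k ω ^ 2) μ := (hΦ k).sub hi2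
  have i2 : Integrable (fun ω => A.potential P f c ν B k ω - κ * A.Δ k ω ^ 2 +
      (A.J P f k)ᶜ.indicator (fun ω => κ * A.Δ k ω ^ 2) ω) μ := i1.add hJ'
  have i3 : Integrable (fun ω => A.potential P f c ν B k ω - κ * A.Δ k ω ^ 2 +
      (A.J P f k)ᶜ.indicator (fun ω => κ * A.Δ k ω ^ 2) ω +
      (A.I P c k)ᶜ.indicator (fun ω => κ * A.Δ k ω ^ 2) ω) μ := i2.add hI'
  have i4 : Integrable (fun ω => A.potential P f c ν B k ω - κ * A.Δ k ω ^ 2 +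
      (A.J P f k)ᶜ.indicator (fun ω => κ * A.Δ k ω ^ 2) ω +
      (A.I P c k)ᶜ.indicator (fun ω => κ * A.Δ k ω ^ 2) ω + ν / P.ε * (Qs ω + Q0 ω)) μ :=
    i3.add hQ
  have hle : ∫ ω, A.potential P f c ν B (k + 1) ω ∂μ ≤
      ∫ ω, (A.potential P f c ν B k ω - κ * A.Δ k ω ^ 2 +
        (A.J P f k)ᶜ.indicator (fun ω => κ * A.Δ k ω ^ 2) ω +
        (A.I P c k)ᶜ.indicator (fun ω => κ * A.Δ k ω ^ 2) ω +
        ν / P.ε * (Qs ω + Q0 ω) + ν / (m * P.ε) * (A.errHs X c k ρ ω +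
          |A.H0 k inf ω - violation c (A.x k inf ω)|)) ∂μ := by
    refine integral_mono (hΦ (k + 1)) (i4.add hH) fun ω => ?_
    refine (potential_succ_le hm hA hν hνγ k ω (hB _ (hAU _ _ _)) (hσ ω) (hρ ω)).trans ?_
    have h1 := mul_le_mul_of_nonneg_left (add_le_add (hQs' ω) (hQ0' ω)) hV.le
    simp only [← hκ] at h1 ⊢
    linarith
  rw [integral_add i4 hH, integral_add i3 hQ, integral_add i2 hI', integral_add i1 hJ',
    integral_sub (hΦ k) hi2, integral_const_mul, integral_const_mul, integral_const_mul,
    integral_add hQs hQ0, integral_add hHs' hH0'] at hle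
  set a := ∫ ω, A.Δ k ω ^ 2 ∂μ with ha
  have ha0 : 0 ≤ a := integral_nonneg fun ω => sq_nonneg _
  have h1 : ν / P.ε * (∫ ω, Qs ω ∂μ + ∫ ω, Q0 ω ∂μ) ≤ 2 * ν * √(1 - β) * a := by
    refine (mul_le_mul_of_nonneg_left (add_le_add hQs'' hQ0'') hV.le).trans (le_of_eq ?_)
    field_simp
    ring
  have h2 : ν / (m * P.ε) * (∫ ω, A.errHs X c k ρ ω ∂μ +
      ∫ ω, |A.H0 k inf ω - violation c (A.x k inf ω)| ∂μ) ≤ 2 * ν * √(1 - α) * a := by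
    refine (mul_le_mul_of_nonneg_left (add_le_add hHs hH0)
      (div_pos hν.1 (mul_pos hm' hε)).le).trans (le_of_eq ?_)
    field_simp
    ring
  have h3 : 4 * ν * (√(1 - α) + 2 * √(1 - β)) ≤ α * β * κ := by
    rw [div_mul_eq_mul_div, div_le_iff₀ hκ0] at hαβ
    exact hαβ
  have h4 : 2 * ν * √(1 - β) * a + 2 * ν * √(1 - α) * a ≤ α * β / 2 * κ * a := by
    rw [← add_mul]
    refine mul_le_mul_of_nonneg_right ?_ ha0
    have h5 := mul_nonneg hν.1.le (Real.sqrt_nonneg (1 - β))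
    linarith
  linarith

/-- The poll size tends to zero almost surely. -/
theorem ae_tendsto_Δ_zero [IsProbabilityMeasure μ] (hm : 0 < m) (hA : A.IsGenerated P)
    (hX : MeasurableSet X) {U : Set (Pt n)} (hU : IsCompact U) (hUX : U ⊆ X)
    (hAU : ∀ k i ω, A.x k i ω ∈ U) {f : Pt n → ℝ} (hf : ContinuousOn f X)
    {c : Fin m → Pt n → ℝ} (hc : ContinuousOn (violation c) X) {ν α β : ℝ}
    (hν : ν ∈ Set.Ioo (0 : ℝ) 1) (hα : α ∈ Set.Ioo (0 : ℝ) 1) (hβ : β ∈ Set.Ioo (0 : ℝ) 1)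
    (hνγ : 2 * (P.τ⁻¹ ^ 2 - 1) / (P.γ - 2) ≤ ν / (1 - ν))
    (hαβ : 4 * ν / ((1 - ν) * (1 - P.τ ^ 2)) * (√(1 - α) + 2 * √(1 - β)) ≤ α * β)
    (hαβ' : α * β ∈ Set.Ioo (1 / 2 : ℝ) 1) (hacc : A.Accurate μ P f c α β) :
    ∀ᵐ ω ∂μ, Tendsto (fun k => A.Δ k ω) atTop (𝓝 0) := by
  have hε := P.ε_pos
  have hV : 0 < ν / P.ε := div_pos hν.1 hε
  have hτ2 : P.τ ^ 2 < 1 := pow_lt_one₀ P.τ_pos.le P.τ_lt_one two_ne_zero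
  obtain ⟨M, hM⟩ := hU.exists_bound_of_continuousOn (hf.mono hUX)
  obtain ⟨B, hBdef⟩ : ∃ B, B = M + (ν / P.ε)⁻¹ * (2 * (P.τ⁻¹ ^ P.zhat) ^ 2) := ⟨_, rfl⟩
  have hB : ∀ x ∈ U, ν / P.ε * (f x - B) + 2 * (P.τ⁻¹ ^ P.zhat) ^ 2 ≤ 0 := by
    intro x hx
    have h1 : f x ≤ M := (le_abs_self _).trans (hM x hx)
    have h2 : ν / P.ε * (f x - B) = ν / P.ε * (f x - M) - 2 * (P.τ⁻¹ ^ P.zhat) ^ 2 := by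
      rw [hBdef, ← sub_sub, mul_sub, mul_inv_cancel_left₀ hV.ne']
    have h3 : ν / P.ε * (f x - M) ≤ 0 :=
      mul_nonpos_of_nonneg_of_nonpos hV.le (by linarith)
    linarith
  set η := (1 - ν) * (1 - P.τ ^ 2) * (α + β - 1 - α * β / 2) with hη
  have hη0 : 0 < η := by
    refine mul_pos (mul_pos (by linarith [hν.2]) (by linarith)) ?_
    -- `α + β - 1 - α * β / 2 = α * β / 2 - (1 - α) * (1 - β)`, and both `α` and `β` exceed `1 / 2`.
    have h1 : 1 / 2 < α := by nlinarith [hα.1, hβ.1, hβ.2, hαβ'.1]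
    have h2 : 1 / 2 < β := by nlinarith [hα.1, hα.2, hβ.1, hαβ'.1]
    nlinarith [mul_pos (sub_pos.2 h1) (sub_pos.2 hβ.2), hαβ'.1]
  set Φ := fun k => ∫ ω, A.potential P f c ν B k ω ∂μ with hΦ
  have hstep : ∀ k, Φ (k + 1) ≤ Φ k - η * ∫ ω, A.Δ k ω ^ 2 ∂μ :=
    integral_potential_succ_le hm hA hX hU hUX hAU hf hc hν hβ hνγ hαβ hacc hB
  have hlow : ∀ k, -(ν / P.ε * (|M| + |B|)) ≤ Φ k := by
    intro k
    have h1 : ∫ _, -(ν / P.ε * (|M| + |B|)) ∂μ ≤ Φ k := by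
      refine integral_mono (integrable_const _)
        (hA.integrable_potential hX hU hUX hAU hf hc ν B k) fun ω => ?_
      have h2 : 0 ≤ ν / (m * P.ε) * violation c (A.x k inf ω) :=
        mul_nonneg (div_nonneg hν.1.le (by positivity)) (violation_nonneg _ _)
      have h3 : 0 ≤ (1 - ν) * A.Δ k ω ^ 2 := mul_nonneg (by linarith [hν.2]) (sq_nonneg _)
      have h4 : -(ν / P.ε * (|M| + |B|)) ≤ {ω | A.flag k ω = true}.indicator
          (fun ω => ν / P.ε * (f (A.x k feas ω) - B)) ω := by
        by_cases h : A.flag k ω = true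
        · simp only [Set.indicator, Set.mem_ofPred_eq, h, if_true]
          rw [← mul_neg]
          refine mul_le_mul_of_nonneg_left ?_ hV.le
          have h5 := neg_le_of_abs_le (hM _ (hAU k feas ω))
          linarith [le_abs_self M, le_abs_self B]
        · simp only [Set.indicator, Set.mem_ofPred_eq, h]
          have : 0 ≤ ν / P.ε * (|M| + |B|) := by positivity
          simpa using this
      simp only [potential]
      linarith
    simpa using h1
  have hsum : Summable fun k => ∫ ω, A.Δ k ω ^ 2 ∂μ := by
    refine summable_of_sum_range_le (c := η⁻¹ * (Φ 0 + ν / P.ε * (|M| + |B|)))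
      (fun k => integral_nonneg fun ω => sq_nonneg _) fun N => ?_
    have h1 : ∀ N, η * ∑ k ∈ Finset.range N, ∫ ω, A.Δ k ω ^ 2 ∂μ ≤ Φ 0 - Φ N := by
      intro N
      induction N with
      | zero => simp
      | succ N ih => rw [Finset.sum_range_succ, mul_add]; linarith [hstep N]
    rw [← div_eq_inv_mul, le_div_iff₀ hη0]
    linarith [h1 N, hlow N]
  filter_upwards [ae_tendsto_zero_of_summable_integral
    (fun k => hA.integrable_Δ_pow (μ := μ) k 2) (fun k ω => sq_nonneg _) hsum] with ω hω
  have h := hω.sqrt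
  simpa [Real.sqrt_sq (hA.Δ_pos _ ω).le] using h

end Run

namespace Run

/-! ### The random walk of reliable iterations -/

open Classical in
/-- The random walk that moves up when the event `E l` occurs and down otherwise. -/
noncomputable def walk {Ω : Type*} (E : ℕ → Set Ω) (k : ℕ) (ω : Ω) : ℤ :=
  ∑ l ∈ Finset.range k, if ω ∈ E l then 1 else -1

variable {Ω : Type*} {n m p : ℕ} {X : Set (Pt n)} {A : Run Ω n m} {P : Params n p X}

theorem walk_succ_of_mem {E : ℕ → Set Ω} {k : ℕ} {ω : Ω} (h : ω ∈ E k) :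
    walk E (k + 1) ω = walk E k ω + 1 := by
  simp [walk, Finset.sum_range_succ, h]

theorem walk_succ_of_notMem {E : ℕ → Set Ω} {k : ℕ} {ω : Ω} (h : ω ∉ E k) :
    walk E (k + 1) ω = walk E k ω - 1 := by
  simp [walk, Finset.sum_range_succ, h, sub_eq_add_neg]

variable {mΩ : MeasurableSpace Ω} {μ : Measure Ω}

/-- If the walk goes up with conditional probability at least `q > 1 / 2`, it tends to infinity:
the expectations of `r ^ W` with `r = 1 / (2 q)` decrease geometrically, by the factor
`(1 - q) / r + q r = 2 q (1 - q) + 1 / 2 < 1`. -/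
theorem ae_tendsto_zpow_walk [IsProbabilityMeasure μ] (hA : A.IsGenerated P) {E : ℕ → Set Ω}
    {q : ℝ} (hq : 1 / 2 < q) (hq1 : q < 1) (hE : ∀ k, CondProbGe μ A k (E k) q)
    (hE' : ∀ k, MeasurableSet[A.past (k + 1)] (E k)) :
    ∀ᵐ ω ∂μ, Tendsto (fun k => ((2 * q)⁻¹ : ℝ) ^ walk E k ω) atTop (𝓝 0) := by
  classical
  have h2q : (0 : ℝ) < 2 * q := by linarith
  have hr0 : 0 < (2 * q)⁻¹ := inv_pos.2 h2q
  have hr1 : (2 * q)⁻¹ ≤ 1 := inv_le_one_of_one_le₀ (by linarith)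
  set r := (2 * q)⁻¹ with hr
  have hrinv : r⁻¹ = 2 * q := by rw [hr, inv_inv]
  have hY0 : ∀ k ω, 0 < r ^ walk E k ω := fun k ω => zpow_pos hr0 _
  have hsucc : ∀ k ω, r ^ walk E (k + 1) ω =
      r⁻¹ * r ^ walk E k ω - (r⁻¹ - r) * (E k).indicator (fun ω => r ^ walk E k ω) ω := by
    intro k ω
    by_cases h : ω ∈ E k
    · rw [walk_succ_of_mem h, zpow_add_one₀ hr0.ne', Set.indicator_of_mem h]
      ring
    · rw [walk_succ_of_notMem h, zpow_sub_one₀ hr0.ne', Set.indicator_of_notMem h]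
      ring
  have hbd : ∀ k ω, r ^ walk E k ω ≤ (2 * q) ^ k := by
    intro k ω
    induction k with
    | zero => simp [walk]
    | succ k ih =>
      rw [hsucc, hrinv, pow_succ']
      have h1 : 0 ≤ (2 * q - r) * (E k).indicator (fun ω => r ^ walk E k ω) ω :=
        mul_nonneg (by linarith) (Set.indicator_nonneg (fun ω _ => (hY0 k ω).le) ω)
      have h2 := mul_le_mul_of_nonneg_left ih h2q.le
      linarith
  have hWm : ∀ k, Measurable[A.past k] (walk E k) := fun k =>
    Finset.measurable_sum _ fun l hl => Measurable.ite
      (A.past_mono (Nat.succ_le_of_lt (Finset.mem_range.1 hl)) _ (hE' l))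
      measurable_const measurable_const
  have hYm : ∀ k, Measurable[A.past k] fun ω => r ^ walk E k ω := fun k =>
    (Measurable.of_discrete (f := fun z : ℤ => r ^ z)).comp (hWm k)
  have hYi : ∀ k, Integrable (fun ω => r ^ walk E k ω) μ := fun k =>
    Integrable.of_bound ((hYm k).mono (hA.past_le k) le_rfl).aestronglyMeasurable ((2 * q) ^ k)
      (Eventually.of_forall fun ω => by
        rw [Real.norm_of_nonneg (hY0 k ω).le]; exact hbd k ω)
  have hstep : ∀ k, ∫ ω, r ^ walk E (k + 1) ω ∂μ ≤
      (2 * q * (1 - q) + 1 / 2) * ∫ ω, r ^ walk E k ω ∂μ := by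
    intro k
    have h1 := (hE k).mul_integral_le hA (hYm k) (fun ω => (hY0 k ω).le) (hbd k)
    have h2 : ∫ ω, r ^ walk E (k + 1) ω ∂μ = r⁻¹ * ∫ ω, r ^ walk E k ω ∂μ -
        (r⁻¹ - r) * ∫ ω, (E k).indicator (fun ω => r ^ walk E k ω) ω ∂μ := by
      simp_rw [hsucc]
      rw [integral_sub ((hYi k).const_mul _) (((hYi k).indicator (hE k).1).const_mul _),
        integral_const_mul, integral_const_mul]
    have h3 := mul_le_mul_of_nonneg_left h1 (show 0 ≤ 2 * q - r by linarith)
    have h4 : r * q = 1 / 2 := by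
      rw [hr]
      field_simp
    rw [h2, hrinv]
    calc 2 * q * ∫ ω, r ^ walk E k ω ∂μ -
          (2 * q - r) * ∫ ω, (E k).indicator (fun ω => r ^ walk E k ω) ω ∂μ
        ≤ 2 * q * ∫ ω, r ^ walk E k ω ∂μ - (2 * q - r) * (q * ∫ ω, r ^ walk E k ω ∂μ) := by
          linarith
      _ = (2 * q * (1 - q) + r * q) * ∫ ω, r ^ walk E k ω ∂μ := by ring
      _ = _ := by rw [h4]
  have hρ0 : 0 ≤ 2 * q * (1 - q) + 1 / 2 := by nlinarith
  have hρ1 : 2 * q * (1 - q) + 1 / 2 < 1 := by nlinarith [mul_pos (sub_pos.2 hq) (sub_pos.2 hq)]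
  have hgeo : ∀ k, ∫ ω, r ^ walk E k ω ∂μ ≤ (2 * q * (1 - q) + 1 / 2) ^ k := by
    intro k
    induction k with
    | zero => simp [walk]
    | succ k ih =>
      rw [pow_succ']
      exact (hstep k).trans (mul_le_mul_of_nonneg_left ih hρ0)
  exact ae_tendsto_zero_of_summable_integral hYi (fun k ω => (hY0 k ω).le)
    (Summable.of_nonneg_of_le (fun k => integral_nonneg fun ω => (hY0 k ω).le) hgeo
      (summable_geometric_of_lt_one hρ0 hρ1))

/-- All the quotients `(h(x) - h(x + δₘ d)) / δₚ` of iteration `k` at `x = x k inf` are at most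
`r`. -/
def SmallDecrease (A : Run Ω n m) (X : Set (Pt n)) (c : Fin m → Pt n → ℝ) (r : ℝ) (k : ℕ)
    (ω : Ω) : Prop :=
  ∀ i, (inf, i) ∈ A.trial X k ω →
    violation c (A.x k inf ω) - violation c (A.pt k (inf, i) ω) ≤ r * A.Δ k ω

/-- A reliable iteration in which the violation could be reduced substantially is successful. Were
all iterations from some index on of this kind, the poll size would dominate a multiple of
`τ ^ (-W)` with the random walk `W` of the reliable iterations, and could not tend to zero. -/
theorem frequently_smallDecrease (hA : A.IsGenerated P) {c : Fin m → Pt n → ℝ} {ω : Ω}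
    (hΔ : Tendsto (fun k => A.Δ k ω) atTop (𝓝 0)) {a : ℝ} (ha0 : 0 < a) (ha1 : a < 1)
    (hW : Tendsto (fun k => a ^ walk (A.I P c) k ω) atTop (𝓝 0)) {r : ℝ} (hr : 0 < r) :
    ∃ᶠ k in atTop, A.SmallDecrease X c r k ω := by
  have hτ := P.τ_pos
  intro hev
  have h1 : ∀ᶠ k in atTop, (P.γ + 2) * m * P.ε * A.Δ k ω ≤ r := by
    have h : Tendsto (fun k => (P.γ + 2) * m * P.ε * A.Δ k ω) atTop (𝓝 0) := by
      simpa using hΔ.const_mul ((P.γ + 2) * m * P.ε)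
    exact (h.eventually_lt_const hr).mono fun k hk => hk.le
  have h2 : ∀ᶠ k in atTop, P.τ⁻¹ * A.Δ k ω ≤ P.τ⁻¹ ^ P.zhat := by
    have h : Tendsto (fun k => P.τ⁻¹ * A.Δ k ω) atTop (𝓝 0) := by
      simpa using hΔ.const_mul P.τ⁻¹
    exact (h.eventually_lt_const (pow_pos (inv_pos.2 hτ) _)).mono fun k hk => hk.le
  obtain ⟨N, hN⟩ := eventually_atTop.1 (hev.and (h1.and h2))
  have hgrow : ∀ k, A.Δ N ω * P.τ⁻¹ ^ (walk (A.I P c) (N + k) ω - walk (A.I P c) N ω) ≤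
      A.Δ (N + k) ω := by
    intro k
    induction k with
    | zero => simp
    | succ k ih =>
      obtain ⟨hns, hk1, hk2⟩ := hN (N + k) (Nat.le_add_right N k)
      have hτi : 0 < P.τ⁻¹ := inv_pos.2 hτ
      rw [← Nat.add_assoc]
      by_cases hI : ω ∈ A.I P c (N + k)
      · have hΔ' : A.Δ (N + k + 1) ω = P.τ⁻¹ * A.Δ (N + k) ω := by
          have hsucc : A.Δ (N + k + 1) ω =
              min (P.τ⁻¹ * A.Δ (N + k) ω) (P.τ⁻¹ ^ P.zhat) := by
            rcases hA.step_cases (N + k) ω with h | h | h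
            · exact h.2.2.2
            · exact h.2.2.2
            · exfalso
              simp only [SmallDecrease, not_forall, not_le] at hns
              obtain ⟨i, hi, hlt⟩ := hns
              refine h.1 ⟨(inf, i), hi, rfl, ?_⟩
              have e1 := (abs_le.1 (abs_H0_sub_le hI inf)).1
              have e2 := (abs_le.1 (abs_Hs_sub_le hI hi)).2
              have e3 := mul_le_mul_of_nonneg_right hk1 (hA.Δ_pos (N + k) ω).le
              linarith
          rw [hsucc, min_eq_left hk2]
        rw [walk_succ_of_mem hI, hΔ', add_sub_right_comm, zpow_add_one₀ hτi.ne']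
        calc _ = P.τ⁻¹ * (A.Δ N ω *
              P.τ⁻¹ ^ (walk (A.I P c) (N + k) ω - walk (A.I P c) N ω)) := by ring
          _ ≤ _ := mul_le_mul_of_nonneg_left ih hτi.le
      · rw [walk_succ_of_notMem hI, sub_right_comm, zpow_sub_one₀ hτi.ne', inv_inv]
        calc _ = P.τ * (A.Δ N ω *
              P.τ⁻¹ ^ (walk (A.I P c) (N + k) ω - walk (A.I P c) N ω)) := by ring
          _ ≤ P.τ * A.Δ (N + k) ω := mul_le_mul_of_nonneg_left ih hτ.le
          _ ≤ _ := hA.τ_mul_Δ_le _ ω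
  have h3 : ∀ᶠ k in atTop, a ^ walk (A.I P c) k ω < a ^ walk (A.I P c) N ω :=
    hW.eventually_lt_const (zpow_pos ha0 _)
  have h4 : ∀ᶠ k in atTop, A.Δ k ω < A.Δ N ω := hΔ.eventually_lt_const (hA.Δ_pos N ω)
  obtain ⟨k, hk, hk3, hk4⟩ := ((eventually_ge_atTop N).and (h3.and h4)).exists
  obtain ⟨j, rfl⟩ := Nat.exists_eq_add_of_le hk
  have h5 : walk (A.I P c) N ω < walk (A.I P c) (N + j) ω :=
    (zpow_lt_zpow_iff_right_of_lt_one₀ ha0 ha1).1 hk3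
  have h6 : 1 ≤ P.τ⁻¹ ^ (walk (A.I P c) (N + j) ω - walk (A.I P c) N ω) :=
    one_le_zpow₀ (one_le_inv_τ P) (by omega)
  have h7 := hgrow j
  have h8 := le_mul_of_one_le_right (hA.Δ_pos N ω).le h6
  linarith

theorem IsGenerated.measurableSet_smallDecrease (hA : A.IsGenerated P) (hX : MeasurableSet X)
    (hx : ∀ k i ω, A.x k i ω ∈ X) {c : Fin m → Pt n → ℝ} (hc : ContinuousOn (violation c) X)
    (r : ℝ) (k : ℕ) : MeasurableSet {ω | A.SmallDecrease X c r k ω} := by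
  have hset : {ω | A.SmallDecrease X c r k ω} = ⋂ i, {ω | (inf, i) ∈ A.trial X k ω}ᶜ ∪
      {ω | violation c (A.x k inf ω) - X.indicator (violation c) (A.pt k (inf, i) ω) ≤
        r * A.Δ k ω} := by
    ext ω
    simp only [SmallDecrease, Set.mem_ofPred_eq, Set.mem_iInter, Set.mem_union, Set.mem_compl_iff]
    refine forall_congr' fun i => ?_
    by_cases hs : (inf, i) ∈ A.trial X k ω
    · simp [hs, Set.indicator_of_mem hs.2.2]
    · simp [hs]
  rw [hset]
  exact MeasurableSet.iInter fun i =>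
    ((hA.past_le k) _ (hA.measurableSet_trial hX k (inf, i))).compl.union (measurableSet_le
      ((measurable_comp_of_continuousOn hX hc (hA.measurable_x k inf) (hx k inf)).sub
        ((measurable_indicator_of_continuousOn hX hc).comp
          ((hA.measurable_pt k (inf, i)).mono (hA.past_le k) le_rfl)))
      ((hA.measurable_Δ k).const_mul r))

theorem Ψ_of_mem {c : Fin m → Pt n → ℝ} {k : ℕ} {d : Pt n} {ω : Ω} (hx : A.x k inf ω ∈ X)
    (hd : A.x k inf ω + A.Δm k ω • d ∈ X) :
    A.Ψ X c k d ω = (((violation c (A.x k inf ω) -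
      violation c (A.x k inf ω + A.Δm k ω • d)) / A.Δ k ω : ℝ) : EReal) := by
  rw [Ψ, violationExt, violationExt, if_pos hx, if_pos hd, EReal.coe_div, EReal.coe_sub]

theorem IsGenerated.Ψ_of_notMem (hA : A.IsGenerated P) {c : Fin m → Pt n → ℝ} {k : ℕ} {d : Pt n}
    {ω : Ω} (hx : A.x k inf ω ∈ X) (hd : A.x k inf ω + A.Δm k ω • d ∉ X) :
    A.Ψ X c k d ω = ⊥ := by
  rw [Ψ, violationExt, violationExt, if_pos hx, if_neg hd, EReal.sub_top,
    EReal.bot_div_of_pos_ne_top (by exact_mod_cast hA.Δ_pos k ω) (EReal.coe_ne_top _)]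

theorem active_inf (A : Run Ω n m) (k : ℕ) (ω : Ω) : A.Active k inf ω := by
  simp [Active]

/-- Along indices with smaller and smaller quotients the upper limit condition on `Ψ` holds; the
polling directions that leave `X` contribute `-∞`. -/
theorem IsGenerated.psiLimLe (hA : A.IsGenerated P) {c : Fin m → Pt n → ℝ}
    (hx : ∀ k i ω, A.x k i ω ∈ X) {κ : ℕ → ℕ} {ω : Ω}
    (h : ∀ i : ℕ, A.SmallDecrease X c (1 / ((i : ℝ) + 1)) (κ i) ω) : A.PsiLimLe X c κ ω := by
  intro d hd
  have hle : ∀ i : ℕ, A.Ψ X c (κ i) (d (κ i)) ω ≤ ((1 / ((i : ℝ) + 1) : ℝ) : EReal) := by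
    intro i
    by_cases hmem : A.x (κ i) inf ω + A.Δm (κ i) ω • d (κ i) ∈ X
    · rw [Ψ_of_mem (hx _ _ _) hmem, EReal.coe_le_coe_iff, div_le_iff₀ (hA.Δ_pos _ ω)]
      obtain ⟨j, hj, hdj⟩ := hd (κ i)
      rw [hdj] at hmem ⊢
      exact h i j ⟨active_inf A _ ω, hj, hmem⟩
    · rw [hA.Ψ_of_notMem (hx _ _ _) hmem]
      exact bot_le
  have hlim : Tendsto (fun i : ℕ => ((1 / ((i : ℝ) + 1) : ℝ) : EReal)) atTop
      (𝓝 ((0 : ℝ) : EReal)) :=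
    (continuous_coe_real_ereal.tendsto 0).comp tendsto_one_div_add_atTop_nhds_zero_nat
  calc limsup (fun i => A.Ψ X c (κ i) (d (κ i)) ω) atTop
      ≤ limsup (fun i : ℕ => ((1 / ((i : ℝ) + 1) : ℝ) : EReal)) atTop :=
        limsup_le_limsup (Eventually.of_forall hle)
    _ = 0 := hlim.limsup_eq

end Run

namespace Run

/-! ### Nonnegativity of the Clarke derivative -/

variable {Ω : Type*} {n m p : ℕ} {X : Set (Pt n)} {A : Run Ω n m} {P : Params n p X}
  {mΩ : MeasurableSpace Ω}

/-- A sequence of difference quotients with nonnegative lower limit bounds the Clarke derivative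
from below. -/
theorem clarkeDeriv_nonneg_of_seq {g : Pt n → ℝ} {z v : Pt n} {y : ℕ → Pt n} {t : ℕ → ℝ}
    (hy : Tendsto y atTop (𝓝 z)) (hyX : ∀ j, y j ∈ X) (ht : Tendsto t atTop (𝓝 0))
    (ht0 : ∀ j, 0 < t j) (hX : ∀ᶠ j in atTop, y j + t j • v ∈ X)
    (h : ∀ r < 0, ∀ᶠ j in atTop, r ≤ (g (y j + t j • v) - g (y j)) / t j) :
    0 ≤ clarkeDeriv X g z v := by
  have h1 : Tendsto (fun j => (y j, t j)) atTop
      ((𝓝[X] z ×ˢ 𝓝[>] (0 : ℝ)) ⊓ 𝓟 {q | q.1 + q.2 • v ∈ X}) :=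
    tendsto_inf.2 ⟨Tendsto.prodMk
      (tendsto_nhdsWithin_iff.2 ⟨hy, Eventually.of_forall hyX⟩)
      (tendsto_nhdsWithin_iff.2 ⟨ht, Eventually.of_forall ht0⟩), tendsto_principal.2 hX⟩
  refine le_of_forall_lt fun b hb => ?_
  obtain ⟨r, hbr, hr⟩ := EReal.lt_iff_exists_real_btwn.1 hb
  refine hbr.trans_le (le_limsup_of_frequently_le ?_)
  refine h1.frequently ((h r (by exact_mod_cast hr)).mono fun j hj => ?_).frequently
  exact_mod_cast hj

theorem IsGenerated.exists_mem_pollDirs (hA : A.IsGenerated P) (hn : 0 < n) (k : ℕ) (ω : Ω) :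
    ∃ d, d ∈ A.pollDirs k inf ω := by
  by_contra! h
  have h1 : A.pollDirs k inf ω = ∅ := Set.eq_empty_of_forall_notMem h
  have h2 := hA.dirs_span k inf ω (active_inf A k ω)
  rw [PositivelySpans, h1, Submodule.span_empty] at h2
  have h3 : (fun _ => 1 : Pt n) ∈ (⊤ : Submodule ℝ≥0 (Pt n)) := trivial
  rw [← h2, Submodule.mem_bot] at h3
  exact one_ne_zero (congrFun h3 ⟨0, hn⟩)

/-- The upper limit condition on `Ψ` concerns choices of a polling direction in every iteration.
Directions that are chosen along a subsequence `φ` only extend to such a choice, because a positive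
spanning set of a nonzero space is nonempty. -/
theorem IsGenerated.eventually_Ψ_lt (hA : A.IsGenerated P) {c : Fin m → Pt n → ℝ} {κ φ : ℕ → ℕ}
    {ω : Ω} (hφ : StrictMono φ) (hκ : StrictMono κ) (hrange : Set.range φ ⊆ Set.range κ)
    (hΨ : A.PsiLimLe X c κ ω) {d : ℕ → Pt n} (hd : ∀ j, d j ∈ A.pollDirs (φ j) inf ω) {r : ℝ}
    (hr : 0 < r) : ∀ᶠ j in atTop, A.Ψ X c (φ j) (d j) ω < r := by
  classical
  -- In dimension zero there are no polling directions.
  have hn : 0 < n := by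
    rcases Nat.eq_zero_or_pos n with rfl | h
    · exact absurd (Subsingleton.elim (d 0) 0)
        (hA.dirs_ne_zero _ _ _ (active_inf A _ ω) _ (hd 0))
    · exact h
  choose e he using fun k => hA.exists_mem_pollDirs hn k ω
  let d' : ℕ → Pt n := fun k => if h : ∃ j, φ j = k then d h.choose else e k
  have hd'φ : ∀ j, d' (φ j) = d j := by
    intro j
    have h : ∃ i, φ i = φ j := ⟨j, rfl⟩
    simp only [d', dif_pos h, hφ.injective h.choose_spec]
  have hd' : ∀ k, d' k ∈ A.pollDirs k inf ω := by
    intro k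
    by_cases h : ∃ j, φ j = k
    · obtain ⟨j, rfl⟩ := h
      rw [hd'φ]
      exact hd j
    · simp only [d', dif_neg h]
      exact he k
  have h1 := eventually_lt_of_limsup_lt
    ((hΨ d' hd').trans_lt (show (0 : EReal) < r by exact_mod_cast hr))
  obtain ⟨N, hN⟩ := eventually_atTop.1 h1
  filter_upwards [hφ.tendsto_atTop.eventually_ge_atTop (κ N)] with j hj
  obtain ⟨i, hi⟩ := hrange ⟨j, rfl⟩
  rw [← hi] at hj
  have h2 := hN i (hκ.le_iff_le.1 hj)
  rwa [hi, hd'φ] at h2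

/-- The deterministic part of the convergence analysis: where the quotients `Ψ` have nonpositive
upper limits, the Clarke derivatives at a refined point in refining directions are nonnegative. -/
theorem IsGenerated.clarkeDeriv_nonneg (hA : A.IsGenerated P) {c : Fin m → Pt n → ℝ}
    (hx : ∀ k i ω, A.x k i ω ∈ X) (hh : LocallyLipschitzOn X (violation c)) {dmin : ℝ}
    (hdmin : 0 < dmin)
    (hd : ∀ k i ω, A.Active k i ω → ∀ d ∈ A.pollDirs k i ω, dmin ≤ A.Δ k ω * ‖d‖)
    {κ κ' : ℕ → ℕ} (hκ : StrictMono κ) (hκ' : StrictMono κ') (hκκ' : Set.range κ ⊆ Set.range κ')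
    {ω : Ω} (hΔ : Tendsto (fun k => A.Δ k ω) atTop (𝓝 0)) (hΨ : A.PsiLimLe X c κ' ω)
    {z : Pt n} (hz : z ∈ X) (hzκ : A.IsRefinedPoint κ ω z) {v : Pt n}
    (hv : v ∈ hypertangentCone X z) (hvκ : A.IsRefiningDirection κ ω v) :
    0 ≤ clarkeDeriv X (violation c) z v := by
  obtain ⟨φ, hφ, hφκ, d, hdφ, hdv⟩ := hvκ
  have hΔφ : Tendsto (fun j => A.Δ (φ j) ω) atTop (𝓝 0) := hΔ.comp hφ.tendsto_atTop
  have hdpos : ∀ j, 0 < ‖d j‖ := fun j =>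
    norm_pos_iff.2 (hA.dirs_ne_zero _ _ _ (active_inf A _ ω) _ (hdφ j))
  have hΔm : ∀ k, 0 < A.Δm k ω := fun k =>
    lt_min (hA.Δ_pos k ω) (pow_pos (hA.Δ_pos k ω) 2)
  set t : ℕ → ℝ := fun j => A.Δm (φ j) ω * ‖d j‖ with ht
  set w : ℕ → Pt n := fun j => ‖d j‖⁻¹ • d j with hw
  have ht0 : ∀ j, 0 < t j := fun j => mul_pos (hΔm _) (hdpos j)
  have htw : ∀ j, t j • w j = A.Δm (φ j) ω • d j := by
    intro j
    rw [ht, hw, smul_smul, mul_assoc, mul_inv_cancel₀ (hdpos j).ne', mul_one]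
  have htlim : Tendsto t atTop (𝓝 0) := by
    refine squeeze_zero (fun j => (ht0 j).le)
      (fun j => hA.dirs_frame _ _ _ (active_inf A _ ω) _ (hdφ j)) ?_
    simpa using hΔφ.mul_const P.b
  have hxlim : Tendsto (fun j => A.x (φ j) inf ω) atTop (𝓝 z) := by
    rw [Metric.tendsto_atTop]
    intro e he
    obtain ⟨N, hN⟩ := Metric.tendsto_atTop.1 hzκ.1 e he
    obtain ⟨M, hM⟩ := eventually_atTop.1 (hφ.tendsto_atTop.eventually_ge_atTop (κ N))
    refine ⟨M, fun j hj => ?_⟩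
    obtain ⟨i, hi⟩ := hφκ ⟨j, rfl⟩
    have h1 := hM j hj
    rw [← hi] at h1 ⊢
    exact hN i (hκ.le_iff_le.1 h1)
  obtain ⟨e, he, hcone⟩ := hv
  obtain ⟨L, s, hs, hL⟩ := hh hz
  have hxX : ∀ j, A.x (φ j) inf ω ∈ X := fun j => hx _ _ _
  have htsmall : ∀ᶠ j in atTop, t j < e := htlim.eventually_lt_const he
  have hwsmall : ∀ᶠ j in atTop, w j ∈ Metric.ball v e := hdv (Metric.ball_mem_nhds v he)
  have hxsmall : ∀ᶠ j in atTop, A.x (φ j) inf ω ∈ Metric.ball z e :=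
    hxlim (Metric.ball_mem_nhds z he)
  have hvX : ∀ᶠ j in atTop, A.x (φ j) inf ω + t j • v ∈ X := by
    filter_upwards [htsmall, hxsmall] with j h1 h2
    exact hcone _ ⟨hxX j, h2⟩ v (Metric.mem_ball_self he) _ (ht0 j) h1
  have hwX : ∀ᶠ j in atTop, A.x (φ j) inf ω + t j • w j ∈ X := by
    filter_upwards [htsmall, hxsmall, hwsmall] with j h1 h2 h3
    exact hcone _ ⟨hxX j, h2⟩ _ h3 _ (ht0 j) h1
  have hvs : ∀ᶠ j in atTop, A.x (φ j) inf ω + t j • v ∈ s := by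
    have h : Tendsto (fun j => A.x (φ j) inf ω + t j • v) atTop (𝓝 z) := by
      simpa using hxlim.add (htlim.smul_const v)
    exact tendsto_nhdsWithin_iff.2 ⟨h, hvX⟩ hs
  have hws : ∀ᶠ j in atTop, A.x (φ j) inf ω + t j • w j ∈ s := by
    have h : Tendsto (fun j => A.x (φ j) inf ω + t j • w j) atTop (𝓝 z) := by
      simpa using hxlim.add (htlim.smul hdv)
    exact tendsto_nhdsWithin_iff.2 ⟨h, hwX⟩ hs
  refine clarkeDeriv_nonneg_of_seq hxlim hxX htlim ht0 hvX fun r hr => ?_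
  -- Half of `-r` accounts for the quotient `Ψ`, the other half for the change of the direction.
  have hρ : 0 < -r / 2 * dmin := mul_pos (by linarith) hdmin
  have hdist : ∀ᶠ j in atTop, L * ‖v - w j‖ < -r / 2 := by
    have h : Tendsto (fun j => L * ‖v - w j‖) atTop (𝓝 0) := by
      simpa using ((tendsto_const_nhds (x := v)).sub hdv).norm.const_mul (L : ℝ)
    exact h.eventually_lt_const (by linarith)
  filter_upwards [hA.eventually_Ψ_lt hφ hκ' (hφκ.trans hκκ') hΨ hdφ hρ, hwX, hvs, hws, hdist,
    hΔφ.eventually_lt_const zero_lt_one] with j h1 h2 h3 h4 h5 h6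
  have hΔj := hA.Δ_pos (φ j) ω
  rw [htw] at h2 h4
  rw [Ψ_of_mem (hxX j) h2, EReal.coe_lt_coe_iff, div_lt_iff₀ hΔj] at h1
  have hlip := hL.dist_le_mul _ h3 _ h4
  rw [Real.dist_eq, ← htw j, dist_add_left, dist_eq_norm, ← smul_sub, norm_smul,
    Real.norm_of_nonneg (ht0 j).le, htw j] at hlip
  have hlip' := (abs_le.1 hlip).1
  -- For small `Δ` the mesh size is `Δ ^ 2`, so the step length `t` is at least `dmin * Δ`.
  have htΔ : dmin * A.Δ (φ j) ω ≤ t j := by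
    have h7 : A.Δm (φ j) ω = A.Δ (φ j) ω ^ 2 :=
      min_eq_right (pow_le_of_le_one hΔj.le h6.le two_ne_zero)
    have h8 := mul_le_mul_of_nonneg_right
      (hd _ _ _ (active_inf A _ ω) _ (hdφ j)) hΔj.le
    calc dmin * A.Δ (φ j) ω ≤ A.Δ (φ j) ω * ‖d j‖ * A.Δ (φ j) ω := h8
      _ = t j := by simp only [ht, h7]; ring
  have h9 : -r / 2 * dmin * A.Δ (φ j) ω ≤ -r / 2 * t j := by
    rw [mul_assoc]
    exact mul_le_mul_of_nonneg_left htΔ (by linarith)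
  have h10 : L * (t j * ‖v - w j‖) ≤ -r / 2 * t j := by
    calc (L : ℝ) * (t j * ‖v - w j‖) = L * ‖v - w j‖ * t j := by ring
      _ ≤ _ := mul_le_mul_of_nonneg_right h5.le (ht0 j).le
  rw [le_div_iff₀ (ht0 j)]
  linarith

end Run
end StoMADSPB

/-! ### Convergence of the algorithm -/

theorem mainTheorem2 {Ω : Type*} [MeasurableSpace Ω] (μ : Measure Ω) [IsProbabilityMeasure μ]
    {n m p : ℕ} (hm : 0 < m)
    -- the problem: the set `X`, the objective function `f` and the constraint functions `c`
    (X : Set (StoMADSPB.Pt n)) (hX : MeasurableSet X)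
    (f : StoMADSPB.Pt n → ℝ) (c : Fin m → StoMADSPB.Pt n → ℝ)
    -- the algorithm and the stochastic process that it generates
    (P : StoMADSPB.Params n p X) (A : StoMADSPB.Run Ω n m) (hA : A.IsGenerated P)
    -- regularity of the problem functions, compactness of the set of iterates
    (hf_lip : LocallyLipschitzOn X f) (hh_lip : LocallyLipschitzOn X (StoMADSPB.violation c))
    (hc_cont : ∀ j, ContinuousOn (c j) X)
    (U : Set (StoMADSPB.Pt n)) (hU : IsCompact U) (hUX : U ⊆ X)
    (hAU : ∀ k i ω, A.x k i ω ∈ U)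
    -- the stopping time is almost surely finite or almost surely infinite
    (hT : (∀ᵐ ω ∂μ, A.T P ω < ⊤) ∨ (∀ᵐ ω ∂μ, A.T P ω = ⊤))
    -- the objective function is bounded from below
    (hf_bdd : ∃ κmin : ℝ, ∀ x ∈ X, κmin ≤ f x)
    -- the choice of the constants, and the accuracy of the estimates
    (ν α β : ℝ) (hν : ν ∈ Set.Ioo (0 : ℝ) 1) (hα : α ∈ Set.Ioo (0 : ℝ) 1)
    (hβ : β ∈ Set.Ioo (0 : ℝ) 1)
    (hνγ : 2 * (P.τ⁻¹ ^ 2 - 1) / (P.γ - 2) ≤ ν / (1 - ν))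
    (hαβ : 4 * ν / ((1 - ν) * (1 - P.τ ^ 2)) * (√(1 - α) + 2 * √(1 - β)) ≤ α * β)
    (hαβ' : α * β ∈ Set.Ioo (1 / 2 : ℝ) 1)
    (hacc : A.Accurate μ P f c α β)
    -- the polling directions, multiplied by the poll size, stay away from zero
    (hdmin : ∃ dmin > 0, ∀ k i ω, A.Active k i ω → ∀ d ∈ A.pollDirs k i ω, dmin ≤ A.Δ k ω * ‖d‖) :
    -- the random index sequences `K ⊆ K'` and the random limit of the refining subsequence
    (∃ (K' K : ℕ → Ω → ℕ) (Xhat : Ω → StoMADSPB.Pt n),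
      (∀ i, Measurable (K' i)) ∧ (∀ i, Measurable (K i)) ∧ Measurable Xhat ∧
      (∀ ω, StrictMono (fun i => K' i ω)) ∧ (∀ ω, StrictMono (fun i => K i ω)) ∧
      (∀ ω, Set.range (fun i => K i ω) ⊆ Set.range (fun i => K' i ω)) ∧
      (∀ᵐ ω ∂μ, Tendsto (fun k => A.Δ k ω) atTop (𝓝 0) ∧
        A.PsiLimLe X c (fun i => K' i ω) ω ∧
        A.IsRefinedPoint (fun i => K i ω) ω (Xhat ω) ∧ Xhat ω ∈ X) ∧
      (∀ ω, Tendsto (fun k => A.Δ k ω) atTop (𝓝 0) → A.PsiLimLe X c (fun i => K' i ω) ω →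
        ∀ z ∈ X, A.IsRefinedPoint (fun i => K i ω) ω z →
          ∀ v ∈ StoMADSPB.hypertangentCone X z, A.IsRefiningDirection (fun i => K i ω) ω v →
            0 ≤ StoMADSPB.clarkeDeriv X (StoMADSPB.violation c) z v)) ∧
    -- with probability one there is such a limit
    (∀ᵐ ω ∂μ, ∃ (κ : ℕ → ℕ) (z : StoMADSPB.Pt n), StrictMono κ ∧ A.IsRefinedPoint κ ω z ∧ z ∈ X ∧
      ∀ v ∈ StoMADSPB.hypertangentCone X z, A.IsRefiningDirection κ ω v →
        0 ≤ StoMADSPB.clarkeDeriv X (StoMADSPB.violation c) z v) := by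
  have hx : ∀ k i ω, A.x k i ω ∈ X := fun k i ω => hUX (hAU k i ω)
  have hc := hh_lip.continuousOn
  have hα2 : 1 / 2 < α := by nlinarith [hα.1, hβ.1, hβ.2, hαβ'.1]
  have hα0 : 0 < (2 * α)⁻¹ := inv_pos.2 (by linarith)
  have hα1 : (2 * α)⁻¹ < 1 := inv_lt_one_of_one_lt₀ (by linarith)
  obtain ⟨dmin, hdmin0, hdmin⟩ := hdmin
  have hΔ := StoMADSPB.Run.ae_tendsto_Δ_zero hm hA hX hU hUX hAU hf_lip.continuousOn hc hν hα hβ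
    hνγ hαβ hαβ' hacc
  have hW := StoMADSPB.Run.ae_tendsto_zpow_walk hA hα2 hα.2 hacc.prob_bounds
    (hA.measurableSet_I hX hx hc)
  obtain ⟨K', hK', hK'mono, hK'mem⟩ := StoMADSPB.exists_measurable_strictMono_mem
    (fun i k => {ω | A.SmallDecrease X c (1 / ((i : ℝ) + 1)) k ω})
    (fun i k => hA.measurableSet_smallDecrease hX hx hc _ k)
  obtain ⟨R, hR⟩ := hU.isBounded.exists_norm_le
  obtain ⟨σ, Xhat, hσ, hXhat, hσmono, hlim⟩ :=
    StoMADSPB.exists_measurable_convergent_subsequence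
      (y := fun i ω => A.x (K' i ω) StoMADSPB.inf ω)
      (fun i => StoMADSPB.measurable_eval_nat (fun k => hA.measurable_x k StoMADSPB.inf) (hK' i))
      (fun i ω => hR _ (hAU _ _ ω))
  have hKmono : ∀ ω, StrictMono fun i => K' (σ i ω) ω := fun ω => (hK'mono ω).comp (hσmono ω)
  have hKK' : ∀ ω, Set.range (fun i => K' (σ i ω) ω) ⊆ Set.range fun i => K' i ω := by
    rintro ω _ ⟨i, rfl⟩
    exact ⟨σ i ω, rfl⟩
  have hXhatX : ∀ ω, Xhat ω ∈ X := fun ω =>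
    hUX (hU.isClosed.mem_of_tendsto (hlim ω) (Eventually.of_forall fun i => hAU _ _ ω))
  have hgood : ∀ᵐ ω ∂μ, Tendsto (fun k => A.Δ k ω) atTop (𝓝 0) ∧
      A.PsiLimLe X c (fun i => K' i ω) ω ∧
      A.IsRefinedPoint (fun i => K' (σ i ω) ω) ω (Xhat ω) ∧ Xhat ω ∈ X := by
    filter_upwards [hΔ, hW] with ω hΔω hWω
    refine ⟨hΔω, hA.psiLimLe hx (hK'mem ω fun i => ?_), ⟨hlim ω, ?_⟩, hXhatX ω⟩
    · exact StoMADSPB.Run.frequently_smallDecrease hA hΔω hα0 hα1 hWω (by positivity)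
    · have h : Tendsto (fun k => A.Δm k ω) atTop (𝓝 0) := by
        simpa [StoMADSPB.Run.Δm] using hΔω.min (hΔω.pow 2)
      exact h.comp (hKmono ω).tendsto_atTop
  have hdet : ∀ ω, Tendsto (fun k => A.Δ k ω) atTop (𝓝 0) →
      A.PsiLimLe X c (fun i => K' i ω) ω →
      ∀ z ∈ X, A.IsRefinedPoint (fun i => K' (σ i ω) ω) ω z →
        ∀ v ∈ StoMADSPB.hypertangentCone X z,
          A.IsRefiningDirection (fun i => K' (σ i ω) ω) ω v →
            0 ≤ StoMADSPB.clarkeDeriv X (StoMADSPB.violation c) z v :=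
    fun ω hΔω hΨ z hz hzK v hv hvK => hA.clarkeDeriv_nonneg hx hh_lip hdmin0 hdmin (hKmono ω)
      (hK'mono ω) (hKK' ω) hΔω hΨ hz hzK hv hvK
  refine ⟨⟨K', fun i ω => K' (σ i ω) ω, Xhat, hK',
    fun i => StoMADSPB.measurable_eval_nat hK' (hσ i), hXhat, hK'mono, hKmono, hKK',
    hgood, hdet⟩, ?_⟩
  filter_upwards [hgood] with ω hω
  exact ⟨_, Xhat ω, hKmono ω, hω.2.2.1, hω.2.2.2, fun v hv hvK =>
    hdet ω hω.1 hω.2.1 _ hω.2.2.2 hω.2.2.1 v hv hvK⟩
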